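/- Let $K$ be an imaginary quadratic field. Then the largest odd prime $p$ for which there exist an elliptic curve $E$ over $K$ and a quadratic extension $L$ of $K$ such that $E(L)$ contains a subgroup isomorphic to $\mathbb{Z}/p\mathbb{Z}\oplus\mathbb{Z}/p\mathbb{Z}$ is $p=3$. That is: (1) for every elliptic curve $E$ over $K$, every quadratic extension $L/K$ and every odd prime $p$, if $E(L)$ contains a subgroup isomorphic to $\mathbb{Z}/p\mathbb{Z}\oplus\mathbb{Z}/p\mathbb{Z}$, then $p=3$; (2) there exist a quadratic extension $L$ of $K$ and an elliptic curve $E$ over $K$ such that $E(L)$ contains a subgroup isomorphic to $\mathbb{Z}/3\mathbb{Z}\oplus\mathbb{Z}/3\mathbb{Z}$. -/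

import Mathlib

universe u v

open Classical in
/-- The group `E(L)` of `L`-rational points of the Weierstrass curve `E` over `K` has a subgroup
isomorphic to `ℤ/p ⊕ ℤ/p`. -/
def ContainsFullTorsion {K : Type*} [Field K] (E : WeierstrassCurve K)
    (L : Type*) [Field L] [Algebra K L] (p : ℕ) : Prop :=
  ∃ H : AddSubgroup (E.baseChange L).toAffine.Point, Nonempty (ZMod p × ZMod p ≃+ H)

open Polynomial WithZero
open scoped Polynomial.Bivariate

/-! Full `p`-torsion over `L` forces a primitive `p`-th root of unity into `L`, and `L` has degree 4
over ℚ. So `p - 1` divides 4, leaving `p = 3` or `p = 5`. If `p = 5`, then `L = ℚ(ζ₅)` is cyclic of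
degree 4, and complex conjugation acts trivially on its quadratic subfield. That subfield is
therefore real and cannot be `K`. For existence, the 3-torsion of `y² = x³ + 16` is defined over any
field containing `√-3`.

The root of unity (`exists_root_of_unity`) comes from an explicit substitute for the Weil pairing.
Over an algebraic closure, let `S`, `T` be independent `p`-torsion points. A function `g` has simple
poles on `⟨S⟩` and simple zeros on `T + ⟨S⟩` (`exists_divisor`). Translation by `S` preserves its
divisor, so it multiplies `g` by a constant `t` (`exists_eq_algebraMap_of_forall_valuation_le`), and
`pS = 0` gives `t ^ p = 1`. If `t = 1`, then `g` would descend to a function with a single simple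
pole on the genus-one quotient by `⟨S⟩`. `false_of_translation_eq` excludes this using only negation
and 2-torsion.

Rationality of `t` needs no descent for `g`. The function `g` is built multiplicatively from
translates of `x - x(A)` by rational points. For these, and so for `g` and its translates, numerator
and denominator can be chosen with norms to `k[X]` whose leading coefficients lie in the small
field. Hence `t²` lies there (`NormLeadingCoeffMem.sq_mem`), and so does `t`, since `p` is odd.

Only the valuation at infinity is constructed. The order of `f` at `P` is read off from the pullback
of `f` under translation by `P`. Values are `exp` of the pole order, so zeros have value less than
1. -/

lemma WithZero.lt_exp_add_one_iff (x : ℤᵐ⁰) (n : ℤ) : x < exp (n + 1) ↔ x ≤ exp n := by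
  induction x using expRecOn with
  | zero => simp
  | exp a => rw [exp_lt_exp, exp_le_exp, Int.lt_add_one_iff]

namespace WeierstrassCurve.Affine

/-! ### The pole order at infinity. -/

namespace CoordinateRing

variable {k : Type*} [Field k] {W : Affine k}

lemma degree_two_nsmul_lt_iff (p : k[X]) (n : ℕ) :
    2 • p.degree < (n : WithBot ℕ) ↔ ∀ i, n ≤ 2 * i → p.coeff i = 0 := by
  rcases eq_or_ne p 0 with rfl | hp
  · simp
  rw [degree_eq_natDegree hp, two_nsmul, ← WithBot.coe_natCast, ← WithBot.coe_add, Nat.cast_withBot,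
    WithBot.coe_lt_coe]
  constructor
  · intro h i hi
    exact coeff_eq_zero_of_natDegree_lt (by simp only [Nat.cast_id] at h; omega)
  · intro h
    by_contra hn
    exact hp (leadingCoeff_eq_zero.mp (h p.natDegree (by simp only [Nat.cast_id] at hn; omega)))

lemma degree_two_nsmul_add_three_lt_iff (p : k[X]) (n : ℕ) :
    2 • p.degree + 3 < (n : WithBot ℕ) ↔ ∀ i, n ≤ 2 * i + 3 → p.coeff i = 0 := by
  rcases eq_or_ne p 0 with rfl | hp
  · simp
  have h3 : (3 : WithBot ℕ) = ((3 : ℕ) : WithBot ℕ) := rfl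
  rw [degree_eq_natDegree hp, two_nsmul, h3, ← Nat.cast_add, ← Nat.cast_add, Nat.cast_lt]
  constructor
  · intro h i hi
    exact coeff_eq_zero_of_natDegree_lt (by omega)
  · intro h
    by_contra hn
    exact hp (leadingCoeff_eq_zero.mp (h p.natDegree (by omega)))

/-- The contributions `2 deg p` and `2 deg q + 3` have opposite parity, so they cannot cancel. A
degree bound on the norm thus becomes a vanishing condition on coefficients. -/
lemma degree_norm_lt_iff (p q : k[X]) (n : ℕ) :
    (Algebra.norm k[X] (p • (1 : W.CoordinateRing) + q • mk W Y)).degree < n ↔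
      (∀ i, n ≤ 2 * i → p.coeff i = 0) ∧ ∀ i, n ≤ 2 * i + 3 → q.coeff i = 0 := by
  rw [degree_norm_smul_basis, max_lt_iff, degree_two_nsmul_lt_iff,
    degree_two_nsmul_add_three_lt_iff]

instance : Module.Finite k[X] W.CoordinateRing := .of_basis (CoordinateRing.basis W)

lemma norm_ne_zero {a : W.CoordinateRing} (ha : a ≠ 0) : Algebra.norm k[X] a ≠ 0 :=
  Algebra.norm_ne_zero_iff.mpr ha

open Classical in
variable (W) in
/-- The order of the pole at infinity, as a function to `ℤᵐ⁰`. -/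
noncomputable def poleOrder (a : W.CoordinateRing) : ℤᵐ⁰ :=
  if a = 0 then 0 else exp ((Algebra.norm k[X] a).natDegree : ℤ)

lemma poleOrder_lt_exp_iff (a : W.CoordinateRing) (n : ℕ) :
    poleOrder W a < exp (n : ℤ) ↔ (Algebra.norm k[X] a).degree < n := by
  rcases eq_or_ne a 0 with rfl | ha
  · simp [poleOrder, Algebra.norm_zero]
  · rw [poleOrder, if_neg ha, exp_lt_exp, degree_eq_natDegree (norm_ne_zero ha)]
    norm_cast

lemma poleOrder_smul_basis_lt_exp_iff (p q : k[X]) (n : ℕ) :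
    poleOrder W (p • (1 : W.CoordinateRing) + q • mk W Y) < exp (n : ℤ) ↔
      (∀ i, n ≤ 2 * i → p.coeff i = 0) ∧ ∀ i, n ≤ 2 * i + 3 → q.coeff i = 0 := by
  rw [poleOrder_lt_exp_iff, degree_norm_lt_iff]

lemma poleOrder_smul_basis_le_exp_iff (p q : k[X]) (n : ℕ) :
    poleOrder W (p • (1 : W.CoordinateRing) + q • mk W Y) ≤ exp (n : ℤ) ↔
      (∀ i, n < 2 * i → p.coeff i = 0) ∧ ∀ i, n < 2 * i + 3 → q.coeff i = 0 := by
  have := poleOrder_smul_basis_lt_exp_iff (W := W) p q (n + 1)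
  rw [Nat.cast_add, Nat.cast_one] at this
  simp only [Nat.succ_le_iff] at this
  rw [← this]
  exact (WithZero.lt_exp_add_one_iff _ _).symm

lemma exists_poleOrder_eq {a : W.CoordinateRing} (ha : a ≠ 0) :
    ∃ n : ℕ, poleOrder W a = exp (n : ℤ) := ⟨_, if_neg ha⟩

/-- A bound on the pole order is a linear condition on coefficients, hence stable under addition.
This supplies the ultrametric inequality. -/
lemma poleOrder_add_le_exp (a b : W.CoordinateRing) (n : ℕ) (ha : poleOrder W a ≤ exp (n : ℤ))
    (hb : poleOrder W b ≤ exp (n : ℤ)) : poleOrder W (a + b) ≤ exp (n : ℤ) := by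
  obtain ⟨p, q, rfl⟩ := exists_smul_basis_eq a
  obtain ⟨r, s, rfl⟩ := exists_smul_basis_eq b
  rw [poleOrder_smul_basis_le_exp_iff] at ha hb
  rw [add_add_add_comm, ← add_smul, ← add_smul, poleOrder_smul_basis_le_exp_iff]
  exact ⟨fun i hi => by rw [coeff_add, ha.1 i hi, hb.1 i hi, add_zero],
    fun i hi => by rw [coeff_add, ha.2 i hi, hb.2 i hi, add_zero]⟩

variable (W) in
/-- The valuation at infinity on the coordinate ring. -/
noncomputable def valuation : Valuation W.CoordinateRing ℤᵐ⁰ where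
  toFun := poleOrder W
  map_zero' := if_pos rfl
  map_one' := by simp [poleOrder]
  map_mul' a b := by
    rcases eq_or_ne a 0 with rfl | ha
    · simp [poleOrder]
    rcases eq_or_ne b 0 with rfl | hb
    · simp [poleOrder]
    rw [poleOrder, poleOrder, poleOrder, if_neg ha, if_neg hb, if_neg (mul_ne_zero ha hb), map_mul,
      natDegree_mul (norm_ne_zero ha) (norm_ne_zero hb), Nat.cast_add, exp_add]
  map_add_le_max' a b := by
    rcases eq_or_ne a 0 with rfl | ha
    · simp
    rcases eq_or_ne b 0 with rfl | hb
    · simp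
    obtain ⟨m, hm⟩ := exists_poleOrder_eq ha
    obtain ⟨n, hn⟩ := exists_poleOrder_eq hb
    have hle := poleOrder_add_le_exp a b (max m n)
      (by rw [hm]; exact exp_le_exp.mpr (by simp)) (by rw [hn]; exact exp_le_exp.mpr (by simp))
    rcases le_total m n with h | h
    · rw [max_eq_right h, ← hn] at hle
      exact hle.trans (le_max_right _ _)
    · rw [max_eq_left h, ← hm] at hle
      exact hle.trans (le_max_left _ _)

lemma valuation_lt_exp_iff (p q : k[X]) (n : ℕ) :
    valuation W (p • (1 : W.CoordinateRing) + q • mk W Y) < exp (n : ℤ) ↔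
      (∀ i, n ≤ 2 * i → p.coeff i = 0) ∧ ∀ i, n ≤ 2 * i + 3 → q.coeff i = 0 :=
  poleOrder_smul_basis_lt_exp_iff p q n

lemma valuation_le_exp_iff (p q : k[X]) (n : ℕ) :
    valuation W (p • (1 : W.CoordinateRing) + q • mk W Y) ≤ exp (n : ℤ) ↔
      (∀ i, n < 2 * i → p.coeff i = 0) ∧ ∀ i, n < 2 * i + 3 → q.coeff i = 0 :=
  poleOrder_smul_basis_le_exp_iff p q n

lemma exists_valuation_eq {a : W.CoordinateRing} (ha : a ≠ 0) :
    ∃ n : ℕ, valuation W a = exp (n : ℤ) := exists_poleOrder_eq ha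

lemma valuation_eq_zero {a : W.CoordinateRing} : valuation W a = 0 ↔ a = 0 := by
  refine ⟨fun h => ?_, fun h => by rw [h, map_zero]⟩
  by_contra ha
  obtain ⟨n, hn⟩ := exists_valuation_eq ha
  exact exp_ne_zero (hn.symm.trans h)

lemma algebraMap_mul_smul_basis (t : k) (p q : k[X]) :
    algebraMap k W.CoordinateRing t * (p • (1 : W.CoordinateRing) + q • mk W Y) =
      (C t * p) • (1 : W.CoordinateRing) + (C t * q) • mk W Y := by
  rw [mul_smul, mul_smul, ← smul_add, Algebra.smul_def (C t)]
  rfl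

/-- Two functions with a pole of the same order at infinity are proportional to first order. -/
lemma exists_valuation_sub_lt {a b : W.CoordinateRing} (hb : b ≠ 0)
    (h : valuation W a ≤ valuation W b) :
    ∃ t : k, valuation W (a - algebraMap k W.CoordinateRing t * b) < valuation W b := by
  obtain ⟨n, hn⟩ := exists_valuation_eq hb
  obtain ⟨p, q, rfl⟩ := exists_smul_basis_eq a
  obtain ⟨r, s, rfl⟩ := exists_smul_basis_eq b
  have hlt := (valuation_lt_exp_iff (W := W) r s n).not.mp hn.not_lt
  have hb' := (valuation_le_exp_iff (W := W) r s n).mp hn.le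
  rw [hn] at h ⊢
  rw [valuation_le_exp_iff] at h
  simp only [algebraMap_mul_smul_basis, add_sub_add_comm, ← sub_smul, valuation_lt_exp_iff,
    coeff_sub, coeff_C_mul]
  rw [not_and_or] at hlt
  push Not at hlt
  -- The parity of the pole order decides whether the leading term is `x ^ m` or `x ^ m * y`. The
  -- constant is the ratio of the leading coefficients.
  rcases hlt with ⟨m, hm, hrm⟩ | ⟨m, hm, hrm⟩
  · have hnm : n = 2 * m := by
      by_contra hne
      exact hrm (hb'.1 m (by omega))
    refine ⟨p.coeff m / r.coeff m, fun i hi => ?_, fun i hi => ?_⟩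
    · rcases eq_or_ne i m with rfl | him
      · field_simp; ring
      · rw [h.1 i (by omega), hb'.1 i (by omega)]; ring
    · rw [h.2 i (by omega), hb'.2 i (by omega)]; ring
  · have hnm : n = 2 * m + 3 := by
      by_contra hne
      exact hrm (hb'.2 m (by omega))
    refine ⟨q.coeff m / s.coeff m, fun i hi => ?_, fun i hi => ?_⟩
    · rw [h.1 i (by omega), hb'.1 i (by omega)]; ring
    · rcases eq_or_ne i m with rfl | him
      · field_simp; ring
      · rw [h.2 i (by omega), hb'.2 i (by omega)]; ring

end CoordinateRing

namespace FunctionField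

variable {k : Type*} [Field k] (W : Affine k)

/-- The valuation at infinity on the function field. -/
noncomputable def valuation : Valuation W.FunctionField ℤᵐ⁰ :=
  (CoordinateRing.valuation W).extendToLocalization (S := nonZeroDivisors W.CoordinateRing)
    (fun _ hx h => nonZeroDivisors.ne_zero hx (CoordinateRing.valuation_eq_zero.mp h))
    W.FunctionField

lemma valuation_algebraMap (a : W.CoordinateRing) :
    valuation W (algebraMap W.CoordinateRing W.FunctionField a) = CoordinateRing.valuation W a :=
  Valuation.extendToLocalization_apply_map_apply _ _ _ _

variable {W}

lemma valuation_algebraMap_base {t : k} (ht : t ≠ 0) :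
    valuation W (algebraMap k W.FunctionField t) = 1 := by
  rw [IsScalarTower.algebraMap_apply k W.CoordinateRing W.FunctionField, valuation_algebraMap]
  have h := CoordinateRing.valuation_le_exp_iff (W := W) (C t) 0 0
  have h' := CoordinateRing.valuation_lt_exp_iff (W := W) (C t) 0 0
  rw [zero_smul, add_zero, Algebra.smul_def, mul_one] at h h'
  refine le_antisymm (h.mpr ⟨fun i hi => ?_, fun i hi => coeff_zero _⟩) (le_of_not_gt fun hlt => ?_)
  · rw [coeff_C_of_ne_zero (by omega)]
  · exact ht (by simpa using (h'.mp hlt).1 0 le_rfl)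

lemma valuation_algebraMap_base_le (t : k) :
    valuation W (algebraMap k W.FunctionField t) ≤ 1 := by
  rcases eq_or_ne t 0 with rfl | ht
  · simp
  · exact (valuation_algebraMap_base ht).le

/-- The residue field at infinity is the base field. -/
lemma exists_valuation_sub_lt {f g : W.FunctionField} (hg : g ≠ 0)
    (h : valuation W f ≤ valuation W g) :
    ∃ t : k, valuation W (f - algebraMap k W.FunctionField t * g) < valuation W g := by
  obtain ⟨a, b, hb, hab⟩ := IsFractionRing.div_surjective (A := W.CoordinateRing) (f / g)
  have hb0 : b ≠ 0 := nonZeroDivisors.ne_zero hb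
  have hb1 : algebraMap W.CoordinateRing W.FunctionField b ≠ 0 := by simpa using hb0
  have hvg : valuation W g ≠ 0 := (Valuation.ne_zero_iff _).mpr hg
  have hvb : valuation W (algebraMap W.CoordinateRing W.FunctionField b) ≠ 0 :=
    (Valuation.ne_zero_iff _).mpr hb1
  have hle : CoordinateRing.valuation W a ≤ CoordinateRing.valuation W b := by
    rw [← valuation_algebraMap, ← valuation_algebraMap]
    have : valuation W (f / g) ≤ 1 := by
      rw [map_div₀]; exact div_le_one_of_le₀ h zero_le
    rw [← hab, map_div₀] at this
    exact (div_le_one₀ (zero_lt_iff.mpr hvb)).mp this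
  obtain ⟨t, ht⟩ := CoordinateRing.exists_valuation_sub_lt hb0 hle
  refine ⟨t, ?_⟩
  rw [← valuation_algebraMap, ← valuation_algebraMap, map_sub, map_mul,
    ← IsScalarTower.algebraMap_apply] at ht
  have hf : f = g * (algebraMap _ W.FunctionField a / algebraMap _ W.FunctionField b) := by
    rw [hab]; field_simp
  have : f - algebraMap k W.FunctionField t * g =
      g / algebraMap W.CoordinateRing W.FunctionField b *
        (algebraMap W.CoordinateRing W.FunctionField a -
        algebraMap k W.FunctionField t * algebraMap W.CoordinateRing W.FunctionField b) := by
    rw [hf]; field_simp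
  rw [this, map_mul, map_div₀]
  calc _ < valuation W g / valuation W (algebraMap W.CoordinateRing W.FunctionField b) *
        valuation W (algebraMap W.CoordinateRing W.FunctionField b) := by
        gcongr
        exact zero_lt_iff.mpr (div_ne_zero hvg hvb)
    _ = _ := div_mul_cancel₀ _ hvb

end FunctionField

open scoped Classical

/-! ### The generic point, translations and negation. -/

namespace FunctionField

variable {k : Type*} [Field k] (W : Affine k)

/-- The coordinate function `x`. -/
noncomputable def x : W.FunctionField :=
  algebraMap W.CoordinateRing W.FunctionField (CoordinateRing.mk W (C X))

/-- The coordinate function `y`. -/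
noncomputable def y : W.FunctionField :=
  algebraMap W.CoordinateRing W.FunctionField (CoordinateRing.mk W Y)

lemma y_sq : y W ^ 2 = x W ^ 3 + algebraMap k W.FunctionField W.a₂ * x W ^ 2 +
    algebraMap k W.FunctionField W.a₄ * x W + algebraMap k W.FunctionField W.a₆ -
    algebraMap k W.FunctionField W.a₁ * x W * y W - algebraMap k W.FunctionField W.a₃ * y W := by
  have h : CoordinateRing.mk W W.polynomial = 0 := AdjoinRoot.mk_self
  have h' := congrArg (algebraMap W.CoordinateRing W.FunctionField) h
  have hc (t : k) : algebraMap W.CoordinateRing W.FunctionField (CoordinateRing.mk W (C (C t))) =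
    algebraMap k W.FunctionField t := rfl
  simp only [polynomial, map_add, map_sub, map_mul, map_pow, map_zero, hc] at h'
  rw [← x, ← y] at h'
  linear_combination h'

lemma equation_baseChange_iff {F : Type*} [Field F] [Algebra k F] (x' y' : F) :
    (W⁄F).Equation x' y' ↔ y' ^ 2 + algebraMap k F W.a₁ * x' * y' + algebraMap k F W.a₃ * y' =
      x' ^ 3 + algebraMap k F W.a₂ * x' ^ 2 + algebraMap k F W.a₄ * x' + algebraMap k F W.a₆ :=
  equation_iff x' y'

lemma equation_x_y : (W⁄W.FunctionField).Equation (x W) (y W) := by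
  rw [equation_baseChange_iff]
  linear_combination y_sq W

variable {W}

lemma algebraMap_smul_basis (p q : k[X]) :
    algebraMap W.CoordinateRing W.FunctionField (p • (1 : W.CoordinateRing) +
      q • CoordinateRing.mk W Y) = aeval (x W) p + aeval (x W) q * y W := by
  have h (p : k[X]) : algebraMap W.CoordinateRing W.FunctionField (CoordinateRing.mk W (C p)) =
      aeval (x W) p := by
    induction p using Polynomial.induction_on' with
    | add p q hp hq => simp only [map_add, hp, hq]
    | monomial n a =>
      rw [← C_mul_X_pow_eq_monomial, map_mul, map_mul, map_mul, map_mul, aeval_C, map_pow, map_pow,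
        map_pow, map_pow, aeval_X]
      rfl
  rw [map_add, CoordinateRing.smul, CoordinateRing.smul, map_mul, map_mul, map_one, mul_one, h, h]
  rfl

lemma algHom_ext {F : Type*} [Field F] [Algebra k F] {φ ψ : W.FunctionField →ₐ[k] F}
    (hx : φ (x W) = ψ (x W)) (hy : φ (y W) = ψ (y W)) : φ = ψ := by
  refine IsLocalization.algHom_ext (nonZeroDivisors W.CoordinateRing) ?_
  refine AlgHom.ext fun a => ?_
  obtain ⟨p, q, rfl⟩ := CoordinateRing.exists_smul_basis_eq a
  simp only [AlgHom.comp_apply]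
  change φ (algebraMap _ _ _) = ψ (algebraMap _ _ _)
  rw [algebraMap_smul_basis]
  simp only [map_add, map_mul, ← aeval_algHom_apply, hx, hy]

/-- A point of the curve with transcendental abscissa defines a homomorphism on the function field. -/
lemma exists_algHom {F : Type*} [Field F] [Algebra k F] {x' y' : F} (h : (W⁄F).Equation x' y')
    (hx : Transcendental k x') :
    ∃ φ : W.FunctionField →ₐ[k] F, φ (x W) = x' ∧ φ (y W) = y' := by
  let g : W.CoordinateRing →ₐ[k] F := AdjoinRoot.liftAlgHom W.polynomial (aeval x') y' (by
    rw [equation_baseChange_iff] at h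
    simp only [polynomial, eval₂_add, eval₂_sub, eval₂_mul, eval₂_pow, eval₂_X, eval₂_C,
      RingHom.coe_coe, map_add, map_mul, map_pow, aeval_X, aeval_C]
    linear_combination h)
  have hgC (p : k[X]) : g (CoordinateRing.mk W (C p)) = aeval x' p :=
    AdjoinRoot.liftAlgHom_of ..
  have hgY : g (CoordinateRing.mk W Y) = y' := AdjoinRoot.liftAlgHom_root ..
  -- A nonzero element of the kernel has a nonzero norm in `k[X]`, and that norm would vanish at
  -- `x'`.
  have hg : Function.Injective g := by
    refine (injective_iff_map_eq_zero g).mpr fun a ha => ?_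
    by_contra ha0
    obtain ⟨p, q, rfl⟩ := CoordinateRing.exists_smul_basis_eq a
    have hN := CoordinateRing.coe_norm_smul_basis (W' := W) p q
    have h1 : CoordinateRing.mk W (C p + C q * X) =
        p • (1 : W.CoordinateRing) + q • CoordinateRing.mk W Y := by
      rw [CoordinateRing.smul, CoordinateRing.smul, map_add, map_mul, mul_one]
    rw [map_mul, h1] at hN
    have := congrArg g hN
    rw [map_mul, ha, zero_mul] at this
    refine hx ⟨_, CoordinateRing.norm_ne_zero ha0, ?_⟩
    rw [← hgC]
    exact this
  refine ⟨IsFractionRing.liftAlgHom hg, ?_, ?_⟩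
  · rw [IsFractionRing.liftAlgHom_apply, x]
    exact (IsFractionRing.lift_algebraMap hg _).trans ((hgC X).trans (aeval_X _))
  · rw [IsFractionRing.liftAlgHom_apply, y]
    exact (IsFractionRing.lift_algebraMap hg _).trans hgY

lemma valuation_aeval_add_lt_exp_iff (p q : k[X]) (n : ℕ) :
    valuation W (aeval (x W) p + aeval (x W) q * y W) < exp (n : ℤ) ↔
      (∀ i, n ≤ 2 * i → p.coeff i = 0) ∧ ∀ i, n ≤ 2 * i + 3 → q.coeff i = 0 := by
  rw [← algebraMap_smul_basis, valuation_algebraMap, CoordinateRing.valuation_lt_exp_iff]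

lemma valuation_aeval_add_le_exp_iff (p q : k[X]) (n : ℕ) :
    valuation W (aeval (x W) p + aeval (x W) q * y W) ≤ exp (n : ℤ) ↔
      (∀ i, n < 2 * i → p.coeff i = 0) ∧ ∀ i, n < 2 * i + 3 → q.coeff i = 0 := by
  rw [← algebraMap_smul_basis, valuation_algebraMap, CoordinateRing.valuation_le_exp_iff]

lemma valuation_aeval_add_eq_exp (p q : k[X]) (n : ℕ)
    (hp : ∀ i, n < 2 * i → p.coeff i = 0) (hq : ∀ i, n < 2 * i + 3 → q.coeff i = 0)
    (h : ∃ i, n = 2 * i ∧ p.coeff i ≠ 0 ∨ n = 2 * i + 3 ∧ q.coeff i ≠ 0) :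
    valuation W (aeval (x W) p + aeval (x W) q * y W) = exp (n : ℤ) := by
  refine le_antisymm ((valuation_aeval_add_le_exp_iff p q n).mpr ⟨hp, hq⟩)
    (le_of_not_gt fun hlt => ?_)
  rw [valuation_aeval_add_lt_exp_iff] at hlt
  obtain ⟨i, ⟨hn, hi⟩ | ⟨hn, hi⟩⟩ := h
  · exact hi (hlt.1 i hn.le)
  · exact hi (hlt.2 i hn.le)

lemma valuation_x_sub (t : k) : valuation W (x W - algebraMap k W.FunctionField t) = exp 2 := by
  have := valuation_aeval_add_eq_exp (W := W) (X - C t) 0 2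
    (fun i hi => by rw [coeff_sub, coeff_X, coeff_C, if_neg (by omega), if_neg (by omega), sub_zero])
    (fun i _ => coeff_zero _)
    ⟨1, Or.inl ⟨rfl, by rw [coeff_sub, coeff_X, coeff_C]; simp⟩⟩
  simpa using this

lemma x_ne_algebraMap (t : k) : x W ≠ algebraMap k W.FunctionField t := by
  intro h
  have := valuation_x_sub (W := W) t
  rw [h, sub_self, map_zero] at this
  exact exp_ne_zero this.symm

lemma exists_eq_algebraMap_of_isAlgebraic {F : Type*} [Field F] [Algebra k F] [IsAlgClosed k]
    {f : F} (hf : IsAlgebraic k f) : ∃ t : k, algebraMap k F t = f := by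
  have := minpoly.mem_range_of_degree_eq_one k f
    (IsAlgClosed.degree_eq_one_of_irreducible k (minpoly.irreducible hf.isIntegral))
  exact this

variable (W) in
/-- Points over the base field as constant points over the function field. -/
noncomputable def constPoint : W.Point →+ (W⁄W.FunctionField).Point :=
  Point.map (W' := W) (F := k) (S := k) (Algebra.ofId k W.FunctionField)

lemma constPoint_some {x₀ y₀ : k} (h : W.Nonsingular x₀ y₀) :
    ∃ h', constPoint W (.some x₀ y₀ h) =
      .some (algebraMap k W.FunctionField x₀) (algebraMap k W.FunctionField y₀) h' := ⟨_, rfl⟩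

lemma map_constPoint (φ : W.FunctionField →ₐ[k] W.FunctionField) (P : W.Point) :
    Point.map (W' := W) φ (constPoint W P) = constPoint W P := by
  rcases P with _ | ⟨x₀, y₀, h⟩
  · exact map_zero _
  · obtain ⟨h', e⟩ := constPoint_some h
    rw [e, Point.map_some]
    simp

variable (W) [W.IsElliptic]

instance : (W⁄W.FunctionField).IsElliptic :=
  inferInstanceAs ((WeierstrassCurve.map W (algebraMap k W.FunctionField)).IsElliptic)

/-- The generic point of the curve. -/
noncomputable def genericPoint : (W⁄W.FunctionField).Point :=
  .some (x W) (y W) (equation_iff_nonsingular.mp (equation_x_y W))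

variable {W}

lemma genericPoint_ne_constPoint (P : W.Point) : genericPoint W ≠ constPoint W P := by
  rcases P with _ | ⟨x₀, y₀, h⟩
  · exact Point.some_ne_zero _
  · obtain ⟨h', e⟩ := constPoint_some h
    rw [e, genericPoint]
    intro heq
    rw [Point.some.injEq] at heq
    exact x_ne_algebraMap _ heq.1

lemma neg_genericPoint_ne_constPoint (P : W.Point) : -genericPoint W ≠ constPoint W P := by
  rw [ne_eq, neg_eq_iff_eq_neg, ← map_neg]
  exact genericPoint_ne_constPoint _

/-- Identities between pullbacks reduce to identities in the group of points over the function
field. -/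
lemma algHom_ext_point {φ ψ : W.FunctionField →ₐ[k] W.FunctionField}
    (h : Point.map (W' := W) φ (genericPoint W) = Point.map (W' := W) ψ (genericPoint W)) :
    φ = ψ := by
  rw [genericPoint, Point.map_some, Point.map_some, Point.some.injEq] at h
  exact algHom_ext h.1 h.2

variable [IsAlgClosed k]

/-- A nonconstant point over the function field defines an endomorphism of the function field. -/
lemma exists_algHom_map_genericPoint (A : (W⁄W.FunctionField).Point)
    (hA : ∀ P, A ≠ constPoint W P) :
    ∃ φ : W.FunctionField →ₐ[k] W.FunctionField, Point.map (W' := W) φ (genericPoint W) = A := by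
  rcases A with _ | ⟨x', y', h⟩
  · exact absurd (map_zero (constPoint W)).symm (hA 0)
  have hx : Transcendental k x' := by
    intro hx
    obtain ⟨x₀, rfl⟩ := exists_eq_algebraMap_of_isAlgebraic hx
    have hy : IsAlgebraic k y' := by
      have h1 := h.1
      rw [equation_baseChange_iff] at h1
      refine ⟨X ^ 2 + C (W.a₁ * x₀ + W.a₃) * X + C (-(x₀ ^ 3 + W.a₂ * x₀ ^ 2 + W.a₄ * x₀ + W.a₆)),
        ?_, ?_⟩
      · refine Monic.ne_zero ?_
        monicity!
      · simp only [map_add, map_mul, map_pow, aeval_X, aeval_C, map_neg]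
        linear_combination h1
    obtain ⟨y₀, rfl⟩ := exists_eq_algebraMap_of_isAlgebraic hy
    exact hA (.some x₀ y₀ ((map_nonsingular (W := W) (f := algebraMap k W.FunctionField)
      (algebraMap k W.FunctionField).injective x₀ y₀).mp h)) rfl
  obtain ⟨φ, rfl, rfl⟩ := exists_algHom h.1 hx
  exact ⟨φ, rfl⟩

/-- If the generic point plus `P` were constant, the generic point itself would be constant. -/
lemma exists_translation (P : W.Point) :
    ∃ φ : W.FunctionField →ₐ[k] W.FunctionField,
      Point.map (W' := W) φ (genericPoint W) = genericPoint W + constPoint W P :=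
  exists_algHom_map_genericPoint _ fun Q h =>
    genericPoint_ne_constPoint (Q - P) (by rw [map_sub, ← h, add_sub_cancel_right])

lemma exists_negation :
    ∃ φ : W.FunctionField →ₐ[k] W.FunctionField,
      Point.map (W' := W) φ (genericPoint W) = -genericPoint W :=
  exists_algHom_map_genericPoint _ fun Q h => neg_genericPoint_ne_constPoint Q h

/-- Pullback of functions along the translation by a point. -/
noncomputable def translation (P : W.Point) : W.FunctionField →ₐ[k] W.FunctionField :=
  (exists_translation P).choose

variable (W) in
/-- Pullback of functions along the negation. -/
noncomputable def negation : W.FunctionField →ₐ[k] W.FunctionField :=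
  (exists_negation (W := W)).choose

lemma map_translation (P : W.Point) :
    Point.map (W' := W) (translation P) (genericPoint W) = genericPoint W + constPoint W P :=
  (exists_translation P).choose_spec

lemma map_negation : Point.map (W' := W) (negation W) (genericPoint W) = -genericPoint W :=
  (exists_negation (W := W)).choose_spec

lemma translation_translation (P Q : W.Point) (f : W.FunctionField) :
    translation P (translation Q f) = translation (P + Q) f := by
  rw [← AlgHom.comp_apply]
  congr 1
  apply algHom_ext_point
  rw [← Point.map_map, map_translation, map_translation, map_add, map_translation, map_constPoint,
    map_add, add_assoc]

lemma translation_zero (f : W.FunctionField) : translation 0 f = f := by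
  have : translation (0 : W.Point) = AlgHom.id k W.FunctionField := algHom_ext_point <| by
    rw [map_translation, map_zero, add_zero]; rfl
  rw [this, AlgHom.id_apply]

lemma negation_negation (f : W.FunctionField) : negation W (negation W f) = f := by
  have : (negation W).comp (negation W) = AlgHom.id k W.FunctionField := algHom_ext_point <| by
    rw [← Point.map_map, map_negation, map_neg, map_negation, neg_neg]; rfl
  exact DFunLike.congr_fun this f

lemma translation_negation (P : W.Point) (f : W.FunctionField) :
    translation P (negation W f) = negation W (translation (-P) f) := by
  rw [← AlgHom.comp_apply, ← AlgHom.comp_apply]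
  congr 1
  apply algHom_ext_point
  rw [← Point.map_map, ← Point.map_map, map_negation, map_neg, map_translation, map_translation,
    map_add, map_negation, map_constPoint, map_neg, neg_add]

lemma negation_x : negation W (x W) = x W := by
  have := map_negation (W := W)
  rw [genericPoint, Point.map_some, Point.neg_some, Point.some.injEq] at this
  exact this.1

lemma negation_y : negation W (y W) = -y W - algebraMap k W.FunctionField W.a₁ * x W -
    algebraMap k W.FunctionField W.a₃ := by
  have := map_negation (W := W)
  rw [genericPoint, Point.map_some, Point.neg_some, Point.some.injEq] at this
  exact this.2

end FunctionField

/-! ### Local behaviour at finite points; functions without poles. -/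

namespace FunctionField

variable {k : Type*} [Field k] {W : Affine k}

lemma valuation_aeval_le {f : W.FunctionField} (hf : valuation W f ≤ 1) (p : k[X]) :
    valuation W (aeval f p) ≤ 1 := by
  induction p using Polynomial.induction_on' with
  | add p q hp hq => rw [map_add]; exact (Valuation.map_add _ _ _).trans (max_le hp hq)
  | monomial n a =>
    rw [aeval_monomial, map_mul, map_pow]
    exact mul_le_one' (valuation_algebraMap_base_le a) (pow_le_one' hf n)

lemma eq_zero_of_valuation_algebraMap_lt {t : k}
    (h : valuation W (algebraMap k W.FunctionField t) < 1) : t = 0 := by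
  by_contra ht
  exact h.ne (valuation_algebraMap_base ht)

lemma valuation_eq_of_mul_pow {f g : W.FunctionField} {n : ℕ} {m : ℤ} (x₀ : k)
    (hfg : f * (x W - algebraMap k W.FunctionField x₀) ^ n = g) (hg : valuation W g = exp m) :
    valuation W f = exp (m - 2 * n) := by
  have := congrArg (valuation W) hfg
  rw [map_mul, map_pow, valuation_x_sub, hg, ← exp_nsmul] at this
  rw [exp_sub, ← this, nsmul_eq_mul, mul_comm (n : ℤ), mul_div_cancel_right₀ _ exp_ne_zero]

lemma valuation_le_of_mul_pow {f g : W.FunctionField} {n : ℕ} {m : ℤ} (x₀ : k)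
    (hfg : f * (x W - algebraMap k W.FunctionField x₀) ^ n = g) (hg : valuation W g ≤ exp m) :
    valuation W f ≤ exp (m - 2 * n) := by
  have := congrArg (valuation W) hfg
  rw [map_mul, map_pow, valuation_x_sub, ← exp_nsmul] at this
  rw [exp_sub, le_div_iff₀ (zero_lt_iff.mpr exp_ne_zero), mul_comm (2 : ℤ), ← nsmul_eq_mul, this]
  exact hg

/-- Multiplying numerator and denominator by the conjugate of the denominator turns the denominator
into its norm. -/
lemma exists_mul_aeval_eq (f : W.FunctionField) : ∃ d p q : k[X], d ≠ 0 ∧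
    f * aeval (x W) d = aeval (x W) p + aeval (x W) q * y W := by
  obtain ⟨a, b, hb, rfl⟩ := IsFractionRing.div_surjective (A := W.CoordinateRing) f
  have hb0 : b ≠ 0 := nonZeroDivisors.ne_zero hb
  obtain ⟨r, s, rfl⟩ := CoordinateRing.exists_smul_basis_eq b
  have hN := CoordinateRing.coe_norm_smul_basis (W' := W) r s
  have h1 : CoordinateRing.mk W (C r + C s * X) =
      r • (1 : W.CoordinateRing) + s • CoordinateRing.mk W Y := by
    rw [CoordinateRing.smul, CoordinateRing.smul, map_add, map_mul, mul_one]
  rw [map_mul, h1] at hN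
  set b := r • (1 : W.CoordinateRing) + s • CoordinateRing.mk W Y
  set b' := CoordinateRing.mk W (C r + C s * (-(Y : k[X][Y]) - C (C W.a₁ * X + C W.a₃)))
  obtain ⟨p, q, hpq⟩ := CoordinateRing.exists_smul_basis_eq (a * b')
  refine ⟨_, p, q, CoordinateRing.norm_ne_zero hb0, ?_⟩
  have h2 := algebraMap_smul_basis (W := W) (Algebra.norm k[X] b) 0
  rw [zero_smul, add_zero, map_zero, zero_mul, add_zero, CoordinateRing.smul, mul_one] at h2
  rw [← algebraMap_smul_basis, hpq, ← h2]
  have hb1 : algebraMap W.CoordinateRing W.FunctionField b ≠ 0 := by simpa using hb0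
  have hN' : CoordinateRing.mk W (C (Algebra.norm k[X] b)) = b * b' := hN
  rw [hN', map_mul, map_mul]
  field_simp

lemma exists_equation [IsAlgClosed k] (x₀ : k) : ∃ y₀, W.Equation x₀ y₀ := by
  obtain ⟨y₀, hy⟩ := IsAlgClosed.exists_root (X ^ 2 + C (W.a₁ * x₀ + W.a₃) * X +
    C (-(x₀ ^ 3 + W.a₂ * x₀ ^ 2 + W.a₄ * x₀ + W.a₆)) : k[X]) (by
      have : (X ^ 2 + C (W.a₁ * x₀ + W.a₃) * X +
        C (-(x₀ ^ 3 + W.a₂ * x₀ ^ 2 + W.a₄ * x₀ + W.a₆)) : k[X]).degree = 2 := by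
        compute_degree!
      rw [this]; norm_num)
  refine ⟨y₀, (equation_iff x₀ y₀).mpr ?_⟩
  simp only [IsRoot, eval_add, eval_mul, eval_pow, eval_X, eval_C] at hy
  linear_combination hy

variable [W.IsElliptic] [IsAlgClosed k]

section

variable {x₀ y₀ : k} (h : W.Nonsingular x₀ y₀)

local notation "c" => algebraMap k W.FunctionField

lemma translation_x_y :
    translation (.some x₀ y₀ h) (x W) = ((y W - c y₀) / (x W - c x₀)) ^ 2 +
      c W.a₁ * ((y W - c y₀) / (x W - c x₀)) - c W.a₂ - x W - c x₀ ∧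
    translation (.some x₀ y₀ h) (y W) = -((y W - c y₀) / (x W - c x₀) *
      (translation (.some x₀ y₀ h) (x W) - x W) + y W) -
      c W.a₁ * translation (.some x₀ y₀ h) (x W) - c W.a₃ := by
  have hm := map_translation (.some x₀ y₀ h)
  obtain ⟨h', e⟩ := constPoint_some h
  have hX : x W ≠ c x₀ := x_ne_algebraMap x₀
  rw [e, genericPoint, Point.map_some, Point.add_of_X_ne hX, Point.some.injEq,
    slope_of_X_ne hX] at hm
  have h1 : translation (.some x₀ y₀ h) (x W) = ((y W - c y₀) / (x W - c x₀)) ^ 2 +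
      c W.a₁ * ((y W - c y₀) / (x W - c x₀)) - c W.a₂ - x W - c x₀ := hm.1
  refine ⟨h1, ?_⟩
  rw [h1]
  exact hm.2

/-- With denominators cleared, the right-hand side is in the basis `1, y`, so its pole order can be
read off. When `x₁ = x₀` the `x²` term drops out and the order is governed by the `y`-coefficient,
which vanishes exactly at 2-torsion. -/
lemma translation_x_sub (x₁ : k) :
    (translation (.some x₀ y₀ h) (x W) - c x₁) * (x W - c x₀) ^ 2 =
      aeval (x W) (C (x₀ - x₁) * X ^ 2 +
        C (W.a₄ - W.a₁ * y₀ + x₀ ^ 2 + 2 * W.a₂ * x₀ + 2 * x₀ * x₁) * X +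
        C (W.a₆ + y₀ ^ 2 + W.a₁ * x₀ * y₀ - W.a₂ * x₀ ^ 2 - x₀ ^ 3 - x₁ * x₀ ^ 2)) +
      aeval (x W) (C (-(2 * y₀ + W.a₁ * x₀ + W.a₃))) * y W := by
  have hX : x W - c x₀ ≠ 0 := sub_ne_zero.mpr (x_ne_algebraMap x₀)
  rw [(translation_x_y h).1]
  simp only [map_add, map_mul, map_sub, map_neg, map_pow, aeval_C, aeval_X, map_ofNat]
  field_simp
  linear_combination y_sq W

lemma translation_y_sub :
    (translation (.some x₀ y₀ h) (y W) - c y₀) * (x W - c x₀) ^ 3 =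
      aeval (x W) (C ((2 * y₀ + W.a₁ * x₀ + W.a₃) * (W.a₂ + 3 * x₀) -
          W.a₁ * (W.a₄ - W.a₁ * y₀ + 3 * x₀ ^ 2 + 2 * W.a₂ * x₀)) * X ^ 2 +
        C ((2 * y₀ + W.a₁ * x₀ + W.a₃) * (W.a₄ - 3 * x₀ ^ 2) -
          W.a₁ * (W.a₆ + y₀ ^ 2 + W.a₁ * x₀ * y₀ - W.a₂ * x₀ ^ 2 - 2 * x₀ ^ 3) +
          (y₀ + W.a₁ * x₀) * (W.a₄ - W.a₁ * y₀ + 3 * x₀ ^ 2 + 2 * W.a₂ * x₀)) * X +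
        C ((2 * y₀ + W.a₁ * x₀ + W.a₃) * (W.a₆ + x₀ ^ 3) + (y₀ + W.a₁ * x₀) *
          (W.a₆ + y₀ ^ 2 + W.a₁ * x₀ * y₀ - W.a₂ * x₀ ^ 2 - 2 * x₀ ^ 3))) +
      aeval (x W) (C (-(W.a₄ - W.a₁ * y₀ + 3 * x₀ ^ 2 + 2 * W.a₂ * x₀)) * X +
        C (-(2 * y₀ + W.a₁ * x₀ + W.a₃) * (W.a₃ + y₀ + W.a₁ * x₀) -
          (W.a₆ + y₀ ^ 2 + W.a₁ * x₀ * y₀ - W.a₂ * x₀ ^ 2 - 2 * x₀ ^ 3))) * y W := by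
  have hX : x W - c x₀ ≠ 0 := sub_ne_zero.mpr (x_ne_algebraMap x₀)
  have h1 := translation_x_sub h x₀
  have h2 : (translation (.some x₀ y₀ h) (y W) - c y₀) * (x W - c x₀) =
      -(y W - c y₀ + c W.a₁ * (x W - c x₀)) * (translation (.some x₀ y₀ h) (x W) - c x₀) -
      c (2 * y₀ + W.a₁ * x₀ + W.a₃) * (x W - c x₀) := by
    rw [(translation_x_y h).2]
    simp only [map_add, map_mul, map_ofNat]
    field_simp
    ring
  have h3 : (translation (.some x₀ y₀ h) (y W) - c y₀) * (x W - c x₀) ^ 3 =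
      -(y W - c y₀ + c W.a₁ * (x W - c x₀)) *
        ((translation (.some x₀ y₀ h) (x W) - c x₀) * (x W - c x₀) ^ 2) -
      c (2 * y₀ + W.a₁ * x₀ + W.a₃) * (x W - c x₀) ^ 3 := by
    linear_combination (x W - c x₀) ^ 2 * h2
  rw [h3, h1]
  simp only [map_add, map_mul, map_sub, map_neg, map_pow, aeval_C, aeval_X, map_ofNat]
  linear_combination (2 * c y₀ + c W.a₁ * c x₀ + c W.a₃) * y_sq W

lemma valuation_translation_x_sub_of_ne {x₁ : k} (hx : x₁ ≠ x₀) :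
    valuation W (translation (.some x₀ y₀ h) (x W) - c x₁) = 1 := by
  refine (valuation_eq_of_mul_pow x₀ (translation_x_sub h x₁) (valuation_aeval_add_eq_exp _ _ 4
    (fun i hi => ?_) (fun i hi => ?_) ⟨2, Or.inl ⟨rfl, ?_⟩⟩)).trans (by norm_num)
  · rw [coeff_add, coeff_add, coeff_C_mul, coeff_C_mul, coeff_X_pow, coeff_X, coeff_C,
      if_neg (by omega), if_neg (by omega), if_neg (by omega)]; ring
  · rw [coeff_C, if_neg (by omega)]
  · rw [coeff_add, coeff_add, coeff_C_mul, coeff_C_mul, coeff_X_pow, coeff_X, coeff_C, if_pos rfl,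
      if_neg (by omega), if_neg (by omega), mul_one, mul_zero, add_zero, add_zero]
    exact sub_ne_zero.mpr hx.symm

lemma valuation_translation_x_sub (hy : 2 * y₀ + W.a₁ * x₀ + W.a₃ ≠ 0) :
    valuation W (translation (.some x₀ y₀ h) (x W) - c x₀) = exp (-1) := by
  refine (valuation_eq_of_mul_pow x₀ (translation_x_sub h x₀) (valuation_aeval_add_eq_exp _ _ 3
    (fun i hi => ?_) (fun i hi => ?_) ⟨0, Or.inr ⟨rfl, ?_⟩⟩)).trans (by norm_num)
  · rw [coeff_add, coeff_add, coeff_C_mul, coeff_C_mul, coeff_X_pow, coeff_X, coeff_C,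
      if_neg (show 1 ≠ i by omega), if_neg (show i ≠ 0 by omega)]; ring
  · rw [coeff_C, if_neg (by omega)]
  · rwa [coeff_C_zero, neg_ne_zero]

lemma valuation_translation_x_sub_lt :
    valuation W (translation (.some x₀ y₀ h) (x W) - c x₀) < 1 := by
  refine (valuation_le_of_mul_pow (m := (3 : ℕ)) x₀ (translation_x_sub h x₀)
    ((valuation_aeval_add_le_exp_iff _ _ _).mpr ⟨fun i hi => ?_, fun i hi => ?_⟩)).trans_lt ?_
  · rw [coeff_add, coeff_add, coeff_C_mul, coeff_C_mul, coeff_X_pow, coeff_X, coeff_C,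
      if_neg (show 1 ≠ i by omega), if_neg (show i ≠ 0 by omega)]; ring
  · rw [coeff_C, if_neg (by omega)]
  · rw [← exp_zero, exp_lt_exp]; norm_num

lemma valuation_translation_y_sub_lt :
    valuation W (translation (.some x₀ y₀ h) (y W) - c y₀) < 1 := by
  refine (valuation_le_of_mul_pow (m := (5 : ℕ)) x₀ (translation_y_sub h)
    ((valuation_aeval_add_le_exp_iff _ _ _).mpr ⟨fun i hi => ?_, fun i hi => ?_⟩)).trans_lt ?_
  · rw [coeff_add, coeff_add, coeff_C_mul, coeff_C_mul, coeff_X_pow, coeff_X, coeff_C,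
      if_neg (by omega), if_neg (by omega), if_neg (by omega)]; ring
  · rw [coeff_add, coeff_C_mul, coeff_X, coeff_C, if_neg (by omega), if_neg (by omega)]; ring
  · rw [← exp_zero, exp_lt_exp]; norm_num

/-- At a 2-torsion point nonsingularity makes the `x`-derivative of the equation nonzero, so `y -
y₀` is a uniformizer and `x - x₀` vanishes to order at least two. -/
lemma valuation_translation_x_sub_lt_y_sub (hy : 2 * y₀ + W.a₁ * x₀ + W.a₃ = 0) :
    valuation W (translation (.some x₀ y₀ h) (x W) - c x₀) <
      valuation W (translation (.some x₀ y₀ h) (y W) - c y₀) := by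
  have hns : W.a₄ - W.a₁ * y₀ + 3 * x₀ ^ 2 + 2 * W.a₂ * x₀ ≠ 0 := by
    have h2 := ((nonsingular_iff' x₀ y₀).mp h).2
    rcases h2 with h2 | h2
    · contrapose! h2
      linear_combination -h2
    · exact absurd hy h2
  have hyv : valuation W (translation (.some x₀ y₀ h) (y W) - c y₀) = exp (-1) := by
    refine (valuation_eq_of_mul_pow x₀ (translation_y_sub h) (valuation_aeval_add_eq_exp _ _ 5
      (fun i hi => ?_) (fun i hi => ?_) ⟨1, Or.inr ⟨rfl, ?_⟩⟩)).trans (by norm_num)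
    · rw [coeff_add, coeff_add, coeff_C_mul, coeff_C_mul, coeff_X_pow, coeff_X, coeff_C,
        if_neg (by omega), if_neg (by omega), if_neg (by omega)]; ring
    · rw [coeff_add, coeff_C_mul, coeff_X, coeff_C, if_neg (by omega), if_neg (by omega)]; ring
    · rw [coeff_add, coeff_C_mul, coeff_X_one, coeff_C, if_neg one_ne_zero, mul_one, add_zero]
      exact neg_ne_zero.mpr hns
  rw [hyv]
  refine (valuation_le_of_mul_pow (m := (2 : ℕ)) x₀ (translation_x_sub h x₀)
    ((valuation_aeval_add_le_exp_iff _ _ _).mpr ⟨fun i hi => ?_, fun i hi => ?_⟩)).trans_lt ?_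
  · rw [coeff_add, coeff_add, coeff_C_mul, coeff_C_mul, coeff_X_pow, coeff_X, coeff_C,
      if_neg (show 1 ≠ i by omega), if_neg (show i ≠ 0 by omega)]; ring
  · rw [hy, neg_zero, C_0, coeff_zero]
  · rw [exp_lt_exp]; norm_num

/-- A function regular at a point has its denominator cancelled by its numerator there. -/
lemma eval_eq_zero_of_valuation_le {f : W.FunctionField} {d p q : k[X]}
    (hf : valuation W (translation (.some x₀ y₀ h) f) ≤ 1)
    (hfd : f * aeval (x W) d = aeval (x W) p + aeval (x W) q * y W) (hd : d.eval x₀ = 0) :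
    p.eval x₀ + q.eval x₀ * y₀ = 0 ∧
      (2 * y₀ + W.a₁ * x₀ + W.a₃ = 0 → q.eval x₀ = 0) := by
  set τ := translation (.some x₀ y₀ h)
  set v := valuation W
  have hx1 : v (τ (x W) - c x₀) < 1 := valuation_translation_x_sub_lt h
  have hy1 : v (τ (y W) - c y₀) < 1 := valuation_translation_y_sub_lt h
  have hx : v (τ (x W)) ≤ 1 := by
    rw [← sub_add_cancel (τ (x W)) (c x₀)]
    exact (Valuation.map_add _ _ _).trans (max_le hx1.le (valuation_algebraMap_base_le _))
  have hy : v (τ (y W)) ≤ 1 := by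
    rw [← sub_add_cancel (τ (y W)) (c y₀)]
    exact (Valuation.map_add _ _ _).trans (max_le hy1.le (valuation_algebraMap_base_le _))
  have key (r : k[X]) : v (aeval (τ (x W)) r - c (r.eval x₀)) ≤ v (τ (x W) - c x₀) := by
    obtain ⟨s, hs⟩ := X_sub_C_dvd_sub_C_eval (a := x₀) (p := r)
    have := congrArg (aeval (τ (x W))) hs
    rw [map_sub, map_mul, map_sub, aeval_X, aeval_C, aeval_C] at this
    rw [this, map_mul]
    exact mul_le_of_le_one_right' (valuation_aeval_le hx s)
  have h1 := congrArg τ hfd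
  rw [map_mul, map_add, map_mul, ← aeval_algHom_apply, ← aeval_algHom_apply,
    ← aeval_algHom_apply] at h1
  have h2 : v (c (p.eval x₀ + q.eval x₀ * y₀) + c (q.eval x₀) * (τ (y W) - c y₀)) ≤
      v (τ (x W) - c x₀) := by
    -- Each term on the right contains a difference `r(x) - r(x₀)`, divisible by `x - x₀`; for `d`
    -- this uses `d(x₀) = 0`.
    have e : c (p.eval x₀ + q.eval x₀ * y₀) + c (q.eval x₀) * (τ (y W) - c y₀) =
        τ f * (aeval (τ (x W)) d - c (d.eval x₀)) - (aeval (τ (x W)) p - c (p.eval x₀)) -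
          (aeval (τ (x W)) q - c (q.eval x₀)) * τ (y W) := by
      rw [hd, map_add, map_mul, map_zero]
      linear_combination -h1
    rw [e]
    refine (Valuation.map_sub _ _ _).trans (max_le ((Valuation.map_sub _ _ _).trans
      (max_le ?_ (key p))) ?_)
    · rw [map_mul]
      exact (mul_le_of_le_one_left' hf).trans (key d)
    · rw [map_mul]
      exact (mul_le_of_le_one_right' hy).trans (key q)
  have h3 : p.eval x₀ + q.eval x₀ * y₀ = 0 := by
    refine eq_zero_of_valuation_algebraMap_lt (W := W) ?_
    rw [← add_sub_cancel_right (c (p.eval x₀ + q.eval x₀ * y₀))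
      (c (q.eval x₀) * (τ (y W) - c y₀))]
    refine (Valuation.map_sub _ _ _).trans_lt (max_lt (h2.trans_lt hx1) ?_)
    rw [map_mul]
    exact (mul_le_of_le_one_left' (valuation_algebraMap_base_le _)).trans_lt hy1
  refine ⟨h3, fun hψ => ?_⟩
  by_contra hq
  rw [h3, map_zero, zero_add, map_mul, valuation_algebraMap_base hq, one_mul] at h2
  exact absurd (valuation_translation_x_sub_lt_y_sub h hψ) h2.not_gt

end

/-- A function without poles is constant. -/
lemma exists_eq_algebraMap_of_forall_valuation_le {f : W.FunctionField}
    (hf : ∀ P : W.Point, valuation W (translation P f) ≤ 1) :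
    ∃ t : k, f = algebraMap k W.FunctionField t := by
  obtain ⟨d, p, q, hd, hfd⟩ := exists_mul_aeval_eq f
  induction hn : d.natDegree generalizing d p q with
  | zero =>
    obtain ⟨e, rfl⟩ := natDegree_eq_zero.mp hn
    have he : e ≠ 0 := by rintro rfl; simp at hd
    have h0 := hf 0
    rw [translation_zero] at h0
    have h1 : valuation W (aeval (x W) p + aeval (x W) q * y W) ≤ exp ((0 : ℕ) : ℤ) := by
      rw [← hfd, map_mul, aeval_C, valuation_algebraMap_base he, mul_one]
      exact h0
    rw [valuation_aeval_add_le_exp_iff] at h1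
    have hq : q = 0 := by ext i; exact h1.2 i (by omega)
    have hp : p = C (p.coeff 0) := by
      ext i
      rcases eq_or_ne i 0 with rfl | hi
      · simp
      · rw [h1.1 i (by omega), coeff_C_of_ne_zero hi]
    rw [hq, hp, map_zero, zero_mul, add_zero, aeval_C, aeval_C] at hfd
    exact ⟨p.coeff 0 / e, by
      rw [map_div₀, ← hfd, mul_div_cancel_right₀ _ ((_root_.map_ne_zero _).mpr he)]⟩
  | succ n ih =>
    obtain ⟨x₀, hx₀⟩ := IsAlgClosed.exists_root d (by
      intro h
      rw [natDegree_eq_zero_iff_degree_le_zero.mpr h.le] at hn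
      exact absurd hn (by omega))
    obtain ⟨y₀, hy₀⟩ := exists_equation (W := W) x₀
    have hP := equation_iff_nonsingular.mp hy₀
    obtain ⟨h1, h2⟩ := eval_eq_zero_of_valuation_le hP (hf _) hfd hx₀
    -- Away from 2-torsion, regularity at both points above `x₀` gives two conditions whose
    -- difference isolates `q(x₀)`. Then `x - x₀` cancels from `d`, `p` and `q`, which drives the
    -- induction on the degree of `d`.
    have hq : q.eval x₀ = 0 := by
      by_cases hψ : 2 * y₀ + W.a₁ * x₀ + W.a₃ = 0
      · exact h2 hψ
      · obtain ⟨h3, -⟩ := eval_eq_zero_of_valuation_le ((nonsingular_neg _ _).mpr hP) (hf _) hfd hx₀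
        rw [negY] at h3
        refine (mul_eq_zero.mp ?_).resolve_right hψ
        linear_combination h1 - h3
    have hp : p.eval x₀ = 0 := by rwa [hq, zero_mul, add_zero] at h1
    obtain ⟨d', rfl⟩ := dvd_iff_isRoot.mpr hx₀
    obtain ⟨p', rfl⟩ := dvd_iff_isRoot.mpr hp
    obtain ⟨q', rfl⟩ := dvd_iff_isRoot.mpr hq
    refine ih d' p' q' (right_ne_zero_of_mul hd) ?_ ?_
    · have hX : x W - algebraMap k W.FunctionField x₀ ≠ 0 := sub_ne_zero.mpr (x_ne_algebraMap x₀)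
      refine mul_left_cancel₀ hX ?_
      simp only [map_mul, map_sub, aeval_X, aeval_C] at hfd
      linear_combination hfd
    · rw [natDegree_mul (X_sub_C_ne_zero x₀) (right_ne_zero_of_mul hd), natDegree_X_sub_C] at hn
      omega

end FunctionField

/-- Meant for negation, which replaces `p + q y` by its conjugate and so preserves the norm. -/
lemma CoordinateRing.valuation_eq_of_norm_eq {k : Type*} [Field k] {W : Affine k}
    {a b : W.CoordinateRing} (h : Algebra.norm k[X] a = Algebra.norm k[X] b) :
    valuation W a = valuation W b := by
  change poleOrder W a = poleOrder W b
  have hab : a = 0 ↔ b = 0 := by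
    rw [← Algebra.norm_eq_zero_iff (R := k[X]), h, Algebra.norm_eq_zero_iff]
  simp only [poleOrder, hab, h]

/-! ### Rationality of leading coefficients; the divisor of `x - x(A)`. -/

namespace FunctionField

variable {k : Type*} [Field k] {W : Affine k}

section LeadingCoeff

/-- A function which is a quotient of two regular functions whose norms have leading coefficient in
the subfield `K`. -/
def NormLeadingCoeffMem (K : Subfield k) (f : W.FunctionField) : Prop :=
  ∃ a b : W.CoordinateRing, a ≠ 0 ∧ b ≠ 0 ∧
    f * algebraMap W.CoordinateRing W.FunctionField b =
      algebraMap W.CoordinateRing W.FunctionField a ∧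
    (Algebra.norm k[X] a).leadingCoeff ∈ K ∧ (Algebra.norm k[X] b).leadingCoeff ∈ K

variable {K : Subfield k}

lemma NormLeadingCoeffMem.one : NormLeadingCoeffMem K (1 : W.FunctionField) :=
  ⟨1, 1, one_ne_zero, one_ne_zero, one_mul _, by simp [K.one_mem], by simp [K.one_mem]⟩

lemma NormLeadingCoeffMem.mul {f g : W.FunctionField} (hf : NormLeadingCoeffMem K f)
    (hg : NormLeadingCoeffMem K g) : NormLeadingCoeffMem K (f * g) := by
  obtain ⟨a, b, ha, hb, hab, hKa, hKb⟩ := hf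
  obtain ⟨a', b', ha', hb', hab', hKa', hKb'⟩ := hg
  refine ⟨a * a', b * b', mul_ne_zero ha ha', mul_ne_zero hb hb', ?_, ?_, ?_⟩
  · rw [map_mul, map_mul, ← hab, ← hab']; ring
  · rw [map_mul, leadingCoeff_mul]; exact K.mul_mem hKa hKa'
  · rw [map_mul, leadingCoeff_mul]; exact K.mul_mem hKb hKb'

lemma NormLeadingCoeffMem.inv {f : W.FunctionField} (hf : NormLeadingCoeffMem K f) :
    NormLeadingCoeffMem K f⁻¹ := by
  obtain ⟨a, b, ha, hb, hab, hKa, hKb⟩ := hf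
  refine ⟨b, a, hb, ha, ?_, hKb, hKa⟩
  have hf0 : f ≠ 0 := by
    rintro rfl
    rw [zero_mul, eq_comm] at hab
    exact ha (by simpa using hab)
  rw [← hab]
  field_simp

/-- The coordinate ring has rank two over `k[X]`, so the norm of a constant is its square. -/
lemma NormLeadingCoeffMem.sq_mem {t : k}
    (h : NormLeadingCoeffMem K (algebraMap k W.FunctionField t)) : t ^ 2 ∈ K := by
  obtain ⟨a, b, ha, hb, hab, hKa, hKb⟩ := h
  have hinj := IsFractionRing.injective W.CoordinateRing W.FunctionField
  rw [IsScalarTower.algebraMap_apply k W.CoordinateRing W.FunctionField, ← map_mul] at hab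
  have hN := congrArg (Algebra.norm k[X]) (hinj hab)
  have h2 : algebraMap k W.CoordinateRing t = algebraMap k[X] W.CoordinateRing (C t) := rfl
  rw [h2, map_mul, Algebra.norm_algebraMap_of_basis (CoordinateRing.basis W), Fintype.card_fin,
    ← C_pow] at hN
  have hl := congrArg leadingCoeff hN
  rw [leadingCoeff_mul, leadingCoeff_C] at hl
  have hb0 : (Algebra.norm k[X] b).leadingCoeff ≠ 0 :=
    leadingCoeff_ne_zero.mpr (CoordinateRing.norm_ne_zero hb)
  rw [eq_div_of_mul_eq hb0 hl]
  exact K.div_mem hKa hKb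

lemma leadingCoeff_norm_mem (h₁ : W.a₁ ∈ K) (h₂ : W.a₂ ∈ K) (h₃ : W.a₃ ∈ K) (h₄ : W.a₄ ∈ K)
    (h₆ : W.a₆ ∈ K) {p q : k[X]} (hp : p ∈ liftsRing K.subtype) (hq : q ∈ liftsRing K.subtype) :
    (Algebra.norm k[X] (p • (1 : W.CoordinateRing) + q • CoordinateRing.mk W Y)).leadingCoeff ∈
      K := by
  have hC {t : k} (ht : t ∈ K) : C t ∈ liftsRing K.subtype := C_mem_lifts K.subtype ⟨t, ht⟩
  have hX : X ∈ liftsRing K.subtype := X_mem_lifts K.subtype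
  have : Algebra.norm k[X] (p • (1 : W.CoordinateRing) + q • CoordinateRing.mk W Y) ∈
      liftsRing K.subtype := by
    rw [CoordinateRing.norm_smul_basis]
    refine sub_mem (sub_mem (pow_mem hp 2) (mul_mem (mul_mem hp hq)
      (add_mem (mul_mem (hC h₁) hX) (hC h₃)))) (mul_mem (pow_mem hq 2) (add_mem (add_mem
      (add_mem (pow_mem hX 3) (mul_mem (hC h₂) (pow_mem hX 2))) (mul_mem (hC h₄) hX)) (hC h₆)))
  obtain ⟨t, ht⟩ := (lifts_iff_coeff_lifts _).mp this
    (Algebra.norm k[X] (p • (1 : W.CoordinateRing) + q • CoordinateRing.mk W Y)).natDegree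
  rw [leadingCoeff, ← ht]
  exact t.2

lemma normLeadingCoeffMem_of_mul_pow (h₁ : W.a₁ ∈ K) (h₂ : W.a₂ ∈ K) (h₃ : W.a₃ ∈ K)
    (h₄ : W.a₄ ∈ K) (h₆ : W.a₆ ∈ K) {p q : k[X]} (hp : p ∈ liftsRing K.subtype)
    (hq : q ∈ liftsRing K.subtype) {f : W.FunctionField} (hf : f ≠ 0) {x₀ : k} (hx₀ : x₀ ∈ K)
    (n : ℕ) (h : f * (x W - algebraMap k W.FunctionField x₀) ^ n =
      aeval (x W) p + aeval (x W) q * y W) : NormLeadingCoeffMem K f := by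
  have hx : x W - algebraMap k W.FunctionField x₀ ≠ 0 := sub_ne_zero.mpr (x_ne_algebraMap x₀)
  have hX : X ∈ liftsRing K.subtype := X_mem_lifts K.subtype
  have hC : C x₀ ∈ liftsRing K.subtype := C_mem_lifts K.subtype ⟨x₀, hx₀⟩
  have hb : algebraMap W.CoordinateRing W.FunctionField
      (((X - C x₀) ^ n) • (1 : W.CoordinateRing) + (0 : k[X]) • CoordinateRing.mk W Y) =
      (x W - algebraMap k W.FunctionField x₀) ^ n := by
    rw [algebraMap_smul_basis]; simp
  rw [← algebraMap_smul_basis, ← hb] at h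
  refine ⟨_, _, ?_, ?_, h, leadingCoeff_norm_mem h₁ h₂ h₃ h₄ h₆ hp hq,
    leadingCoeff_norm_mem h₁ h₂ h₃ h₄ h₆ (pow_mem (sub_mem hX hC) n) (zero_mem _)⟩
  · intro h0
    rw [h0, map_zero, hb] at h
    exact mul_ne_zero hf (pow_ne_zero n hx) h
  · intro h0
    rw [h0, map_zero] at hb
    exact pow_ne_zero n hx hb.symm

end LeadingCoeff

variable [W.IsElliptic] [IsAlgClosed k]

lemma valuation_negation (f : W.FunctionField) :
    valuation W (negation W f) = valuation W f := by
  obtain ⟨d, p, q, hd, hfd⟩ := exists_mul_aeval_eq f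
  have hd0 : valuation W (aeval (x W) d) ≠ 0 := by
    have := algebraMap_smul_basis (W := W) d 0
    rw [map_zero, zero_mul, add_zero] at this
    rw [← this, valuation_algebraMap, ne_eq, CoordinateRing.valuation_eq_zero]
    exact fun h => hd (CoordinateRing.smul_basis_eq_zero h).1
  have h1 := congrArg (negation W) hfd
  rw [map_mul, map_add, map_mul, ← aeval_algHom_apply, ← aeval_algHom_apply,
    ← aeval_algHom_apply, negation_x, negation_y] at h1
  have h2 : negation W f * aeval (x W) d =
      aeval (x W) (p - q * (C W.a₁ * X + C W.a₃)) + aeval (x W) (-q) * y W := by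
    rw [h1]
    simp only [map_sub, map_mul, map_add, map_neg, aeval_C, aeval_X]
    ring
  have h3 : valuation W (aeval (x W) (p - q * (C W.a₁ * X + C W.a₃)) + aeval (x W) (-q) * y W) =
      valuation W (aeval (x W) p + aeval (x W) q * y W) := by
    rw [← algebraMap_smul_basis, ← algebraMap_smul_basis, valuation_algebraMap,
      valuation_algebraMap]
    refine CoordinateRing.valuation_eq_of_norm_eq ?_
    rw [CoordinateRing.norm_smul_basis, CoordinateRing.norm_smul_basis]
    ring
  have h4 := congrArg (valuation W) h2
  rw [h3, ← hfd, map_mul, map_mul] at h4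
  exact mul_right_cancel₀ hd0 h4

lemma valuation_translation_negation (P : W.Point) (f : W.FunctionField) :
    valuation W (translation P (negation W f)) = valuation W (translation (-P) f) := by
  rw [translation_negation, valuation_negation]

/-- The divisor of `x - x(A)`, with the sign of poles. -/
lemma valuation_translation_x_sub_abscissa {x₁ y₁ : k} (h : W.Nonsingular x₁ y₁)
    (hA : (Point.some x₁ y₁ h : W.Point) ≠ -Point.some x₁ y₁ h) (P : W.Point) :
    valuation W (translation P (x W - algebraMap k W.FunctionField x₁)) =
      exp ((2 • Pi.single (0 : W.Point) (1 : ℤ) - Pi.single (Point.some x₁ y₁ h) 1 -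
        Pi.single (-Point.some x₁ y₁ h) 1 : W.Point → ℤ) P) := by
  simp only [Pi.sub_apply, Pi.smul_apply, Pi.single_apply]
  rcases P with _ | ⟨x₀, y₀, h₀⟩
  · have h1 : (Point.zero : W.Point) ≠ Point.some x₁ y₁ h := nofun
    have h2 : (Point.zero : W.Point) ≠ -Point.some x₁ y₁ h := nofun
    rw [if_pos Point.zero_def.symm, if_neg h1, if_neg h2, ← Point.zero_def, translation_zero,
      valuation_x_sub]
    rfl
  rw [map_sub, AlgHom.commutes, if_neg (Point.some_ne_zero h₀)]
  by_cases hx : x₁ = x₀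
  · have hy : 2 * y₀ + W.a₁ * x₀ + W.a₃ ≠ 0 := by
      intro hy
      apply hA
      rcases Point.X_eq_iff (h₁ := h) (h₂ := h₀) |>.mp hx with h3 | h3
      · rw [h3, Point.neg_some, Point.some.injEq]
        exact ⟨rfl, by rw [negY]; linear_combination hy⟩
      · rw [h3, neg_neg, Point.neg_some, Point.some.injEq]
        exact ⟨rfl, by rw [negY]; linear_combination -hy⟩
    refine (congrArg (fun t => valuation W (translation (.some x₀ y₀ h₀) (x W) -
      algebraMap k W.FunctionField t)) hx).trans ((valuation_translation_x_sub h₀ hy).trans ?_)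
    rcases Point.X_eq_iff (h₁ := h) (h₂ := h₀) |>.mp hx with h3 | h3
    · rw [if_pos h3.symm, if_neg (h3 ▸ hA)]; norm_num
    · have h4 : Point.some x₀ y₀ h₀ = -Point.some x₁ y₁ h := by rw [h3, neg_neg]
      rw [if_pos h4, if_neg (h4 ▸ hA.symm)]; norm_num
  · rw [valuation_translation_x_sub_of_ne h₀ hx, if_neg, if_neg]
    · norm_num
    · intro h3
      rw [Point.neg_some, Point.some.injEq] at h3
      exact hx h3.1.symm
    · intro h3
      rw [Point.some.injEq] at h3
      exact hx h3.1.symm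

/-- The coefficients in `translation_x_sub` are polynomials over ℤ in the curve coefficients, `x₁`,
and the coordinates of `P`. -/
lemma normLeadingCoeffMem_translation {K : Subfield k} (h₁ : W.a₁ ∈ K) (h₂ : W.a₂ ∈ K)
    (h₃ : W.a₃ ∈ K) (h₄ : W.a₄ ∈ K) (h₆ : W.a₆ ∈ K) {x₁ : k} (hx₁ : x₁ ∈ K) (P : W.Point)
    (hP : ∀ x₀ y₀ h, P = .some x₀ y₀ h → x₀ ∈ K ∧ y₀ ∈ K) :
    NormLeadingCoeffMem K (translation P (x W - algebraMap k W.FunctionField x₁)) := by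
  have hC {t : k} (ht : t ∈ K) : C t ∈ liftsRing K.subtype := C_mem_lifts K.subtype ⟨t, ht⟩
  have hX : X ∈ liftsRing K.subtype := X_mem_lifts K.subtype
  have hne : translation P (x W - algebraMap k W.FunctionField x₁) ≠ 0 :=
    (_root_.map_ne_zero _).mpr (sub_ne_zero.mpr (x_ne_algebraMap x₁))
  have h2 : (2 : k) ∈ K := ofNat_mem K 2
  rcases P with _ | ⟨x₀, y₀, h₀⟩
  · refine normLeadingCoeffMem_of_mul_pow h₁ h₂ h₃ h₄ h₆ (p := X - C x₁) (q := 0)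
      (sub_mem hX (hC hx₁)) (zero_mem _) hne hx₁ 0 ?_
    rw [← Point.zero_def, translation_zero]
    simp
  · obtain ⟨hx₀, hy₀⟩ := hP _ _ _ rfl
    have hid := translation_x_sub h₀ x₁
    rw [map_sub, AlgHom.commutes] at hne ⊢
    refine normLeadingCoeffMem_of_mul_pow h₁ h₂ h₃ h₄ h₆ ?_ ?_ hne hx₀ 2 hid
    · refine add_mem (add_mem (mul_mem (hC ?_) (pow_mem hX 2)) (mul_mem (hC ?_) hX)) (hC ?_)
      · exact sub_mem hx₀ hx₁
      · exact add_mem (add_mem (add_mem (sub_mem h₄ (mul_mem h₁ hy₀)) (pow_mem hx₀ 2))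
          (mul_mem (mul_mem h2 h₂) hx₀)) (mul_mem (mul_mem h2 hx₀) hx₁)
      · exact sub_mem (sub_mem (sub_mem (add_mem (add_mem h₆ (pow_mem hy₀ 2))
          (mul_mem (mul_mem h₁ hx₀) hy₀)) (mul_mem h₂ (pow_mem hx₀ 2))) (pow_mem hx₀ 3))
          (mul_mem hx₁ (pow_mem hx₀ 2))
    · exact hC (neg_mem (add_mem (add_mem (mul_mem h2 hy₀) (mul_mem h₁ hx₀)) h₃))

end FunctionField

lemma _root_.AddSubgroup.sum_single_nsmul {A : Type*} [AddCommGroup A] [DecidableEq A] (S : A) {p : ℕ} (hS : addOrderOf S = p) (hp : 0 < p) (P : A) :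
    ∑ i ∈ Finset.range p, (Pi.single (i • S) 1 : A → ℤ) P =
      if P ∈ AddSubgroup.zmultiples S then 1 else 0 := by
  have hfin : IsOfFinAddOrder S := addOrderOf_pos_iff.mp (hS ▸ hp)
  split_ifs with h
  · obtain ⟨i, hi, rfl⟩ := Finset.mem_image.mp
      ((hfin.mem_zmultiples_iff_mem_range_addOrderOf).mp h)
    rw [hS] at hi
    rw [Finset.sum_eq_single i]
    · simp
    · intro j hj hji
      refine Pi.single_eq_of_ne ?_ _
      intro he
      exact hji (nsmul_injOn_Iio_addOrderOf (by simpa [hS] using hj) (by simpa [hS] using hi)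
        he.symm)
    · exact fun h => absurd hi h
  · refine Finset.sum_eq_zero fun i _ => Pi.single_eq_of_ne ?_ _
    rintro rfl
    exact h (nsmul_mem (AddSubgroup.mem_zmultiples S) i)

/-! ### Principal divisors supported on rational torsion. -/

namespace FunctionField

variable {k : Type*} [Field k] {W : Affine k} [W.IsElliptic] [IsAlgClosed k]

section Principal

variable (K : Subfield k) (G : AddSubgroup W.Point)

/-- The pole orders (negatives of divisors) of functions whose translates by points of `G` have
norms with leading coefficients in `K`. -/
def principal : AddSubgroup (W.Point → ℤ) where
  carrier := {D | ∃ f : W.FunctionField, (∀ P, valuation W (translation P f) = exp (D P)) ∧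
    ∀ Q ∈ G, NormLeadingCoeffMem K (translation Q f)}
  zero_mem' := ⟨1, fun P => by simp, fun Q _ => by rw [map_one]; exact .one⟩
  add_mem' := by
    rintro D E ⟨f, hf, hf'⟩ ⟨g, hg, hg'⟩
    refine ⟨f * g, fun P => ?_, fun Q hQ => ?_⟩
    · rw [map_mul, map_mul, hf, hg, Pi.add_apply, exp_add]
    · rw [map_mul]
      exact (hf' Q hQ).mul (hg' Q hQ)
  neg_mem' := by
    rintro D ⟨f, hf, hf'⟩
    refine ⟨f⁻¹, fun P => ?_, fun Q hQ => ?_⟩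
    · rw [map_inv₀, map_inv₀, hf, Pi.neg_apply, exp_neg]
    · rw [map_inv₀]
      exact (hf' Q hQ).inv

variable {K G}

/-- The divisor of the translate of `x - x(A)` by `C`. -/
lemma two_nsmul_single_sub_mem_principal (h₁ : W.a₁ ∈ K) (h₂ : W.a₂ ∈ K)
    (h₃ : W.a₃ ∈ K) (h₄ : W.a₄ ∈ K) (h₆ : W.a₆ ∈ K)
    (hG : ∀ x y h, Point.some x y h ∈ G → x ∈ K ∧ y ∈ K)
    (hG2 : ∀ P ∈ G, P + P = 0 → P = 0) {A C : W.Point} (hA : A ∈ G) (hC : C ∈ G) :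
    2 • Pi.single C (1 : ℤ) - Pi.single (C + A) 1 - Pi.single (C - A) 1 ∈ principal K G := by
  rcases eq_or_ne A 0 with rfl | hA0
  · rw [add_zero, sub_zero, two_nsmul, add_sub_cancel_right, sub_self]
    exact zero_mem _
  rcases A with _ | ⟨x₁, y₁, h⟩
  · exact absurd rfl hA0
  have hne : Point.some x₁ y₁ h ≠ -Point.some x₁ y₁ h := fun he =>
    hA0 (hG2 _ hA (eq_neg_iff_add_eq_zero.mp he))
  refine ⟨translation (-C) (x W - algebraMap k W.FunctionField x₁), fun P => ?_, fun Q hQ => ?_⟩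
  · rw [translation_translation, valuation_translation_x_sub_abscissa h hne]
    have e₁ : P + -C = 0 ↔ P = C := by rw [← sub_eq_add_neg, sub_eq_zero]
    have e₂ (A : W.Point) : P + -C = A ↔ P = C + A := by
      rw [← sub_eq_add_neg, sub_eq_iff_eq_add, add_comm]
    simp only [Pi.sub_apply, Pi.smul_apply, Pi.single_apply, sub_eq_add_neg C, e₁, e₂]
  · rw [translation_translation]
    refine normLeadingCoeffMem_translation h₁ h₂ h₃ h₄ h₆ (hG _ _ _ hA).1 _ fun x₀ y₀ h₀ he => ?_
    refine hG x₀ y₀ h₀ ?_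
    rw [← he]
    exact add_mem hQ (neg_mem hC)

/-- Choosing `C` with `2C = A + B` avoids chord functions. The wanted divisor is `2(C) - (A) - (B)`
minus `2(C) - (2C) - (0)`, both coming from translates of functions `x - x(·)`. -/
lemma single_add_single_sub_mem_principal (h₁ : W.a₁ ∈ K) (h₂ : W.a₂ ∈ K)
    (h₃ : W.a₃ ∈ K) (h₄ : W.a₄ ∈ K) (h₆ : W.a₆ ∈ K)
    (hG : ∀ x y h, Point.some x y h ∈ G → x ∈ K ∧ y ∈ K)
    (hG2 : ∀ P ∈ G, P + P = 0 → P = 0) (hdiv : ∀ P ∈ G, ∃ Q ∈ G, Q + Q = P)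
    {A B : W.Point} (hA : A ∈ G) (hB : B ∈ G) :
    Pi.single (A + B) (1 : ℤ) + Pi.single 0 1 - Pi.single A 1 - Pi.single B 1 ∈
      principal K G := by
  obtain ⟨C, hC, hCC⟩ := hdiv _ (add_mem hA hB)
  have e1 := two_nsmul_single_sub_mem_principal h₁ h₂ h₃ h₄ h₆ hG hG2 (sub_mem hA hC) hC
  have e2 := two_nsmul_single_sub_mem_principal h₁ h₂ h₃ h₄ h₆ hG hG2 hC hC
  rw [add_sub_cancel, show C - (A - C) = B by rw [sub_sub_eq_add_sub, hCC, add_sub_cancel_left]]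
    at e1
  rw [hCC, sub_self] at e2
  convert sub_mem e1 e2 using 1
  abel

/-- A function with divisor `∑ (T + iS) - ∑ (iS)`. -/
lemma exists_divisor (h₁ : W.a₁ ∈ K) (h₂ : W.a₂ ∈ K)
    (h₃ : W.a₃ ∈ K) (h₄ : W.a₄ ∈ K) (h₆ : W.a₆ ∈ K)
    (hG : ∀ x y h, Point.some x y h ∈ G → x ∈ K ∧ y ∈ K)
    (hG2 : ∀ P ∈ G, P + P = 0 → P = 0) (hdiv : ∀ P ∈ G, ∃ Q ∈ G, Q + Q = P)
    {S T : W.Point} (hS : S ∈ G) (hT : T ∈ G) {p : ℕ} (hp : 0 < p) (hSp : addOrderOf S = p)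
    (hTp : p • T = 0) :
    ∃ g : W.FunctionField, (∀ P, valuation W (translation P g) =
      exp ((if P ∈ AddSubgroup.zmultiples S then 1 else 0) -
        (if P - T ∈ AddSubgroup.zmultiples S then 1 else 0) : ℤ)) ∧
      ∀ Q ∈ G, NormLeadingCoeffMem K (translation Q g) := by
  -- `A ↦ (A) - (0)` is additive modulo principal divisors. Each summand below then has class `-cl
  -- T`, and `p` of them cancel because `pT = 0`.
  let cl : G →+ (W.Point → ℤ) ⧸ principal K G := AddMonoidHom.mk'
    (fun A => QuotientAddGroup.mk (Pi.single (A : W.Point) (1 : ℤ) - Pi.single 0 1)) fun A B => by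
      rw [← QuotientAddGroup.mk_add, QuotientAddGroup.eq]
      rw [← neg_mem_iff]
      convert single_add_single_sub_mem_principal h₁ h₂ h₃ h₄ h₆ hG hG2 hdiv A.2 B.2 using 1
      rw [AddSubgroup.coe_add]
      abel
  have hmem : ∑ i ∈ Finset.range p, (Pi.single (i • S) (1 : ℤ) - Pi.single (T + i • S) 1) ∈
      principal K G := by
    rw [← QuotientAddGroup.eq_zero_iff, QuotientAddGroup.mk_sum]
    have : ∀ i ∈ Finset.range p, (QuotientAddGroup.mk (Pi.single (i • S) (1 : ℤ) -
        Pi.single (T + i • S) 1) : (W.Point → ℤ) ⧸ principal K G) = -cl ⟨T, hT⟩ := by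
      intro i _
      have h1 : cl (i • ⟨S, hS⟩) - cl (⟨T, hT⟩ + i • ⟨S, hS⟩) = -cl ⟨T, hT⟩ := by
        rw [map_add]; abel
      rw [← h1]
      change _ = QuotientAddGroup.mk _ - QuotientAddGroup.mk _
      rw [← QuotientAddGroup.mk_sub]
      congr 1
      exact (sub_sub_sub_cancel_right _ _ _).symm
    rw [Finset.sum_congr rfl this, Finset.sum_const, Finset.card_range, ← map_neg,
      ← map_nsmul, neg_nsmul, show p • (⟨T, hT⟩ : G) = 0 from Subtype.ext hTp, neg_zero, map_zero]
  obtain ⟨g, hg, hg'⟩ := hmem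
  refine ⟨g, fun P => ?_, hg'⟩
  rw [hg, Finset.sum_apply]
  simp only [Pi.sub_apply]
  rw [Finset.sum_sub_distrib, AddSubgroup.sum_single_nsmul S hSp hp,
    ← AddSubgroup.sum_single_nsmul S hSp hp (P - T)]
  congr 3
  ext i
  simp only [Pi.single_apply, sub_eq_iff_eq_add, add_comm T]

end Principal

/-! ### Nontriviality of the translation constant, and the root of unity. -/

lemma translation_eq_of_mem_zmultiples {f : W.FunctionField} {S Q : W.Point}
    (hf : translation S f = f) (hQ : Q ∈ AddSubgroup.zmultiples S) : translation Q f = f := by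
  let H : AddSubgroup W.Point :=
    { carrier := {P | translation P f = f}
      zero_mem' := translation_zero f
      add_mem' := fun {P Q} (hP : translation P f = f) (hQ : translation Q f = f) => by
        change translation (P + Q) f = f
        rw [← translation_translation, hQ, hP]
      neg_mem' := fun {P} (hP : translation P f = f) => by
        change translation (-P) f = f
        nth_rewrite 1 [← hP]
        rw [translation_translation, neg_add_cancel, translation_zero] }
  exact (AddSubgroup.zmultiples_le (H := H)).mpr hf hQ

/-- An odd function vanishes at the points of order two at which it is regular. -/
lemma valuation_translation_lt_one_of_negation_eq_neg (h2 : (2 : k) ≠ 0) {f : W.FunctionField}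
    (hf : negation W f = -f) {Q : W.Point} (hQ : -Q = Q)
    (hreg : valuation W (translation Q f) ≤ 1) : valuation W (translation Q f) < 1 := by
  obtain ⟨t, ht⟩ := exists_valuation_sub_lt (f := translation Q f) one_ne_zero
    (by rwa [map_one])
  rw [mul_one, map_one] at ht
  have h1 : negation W (translation Q f) = -translation Q f := by
    rw [← hQ, ← translation_negation, hf, map_neg, hQ]
  have h3 := ht
  rw [← valuation_negation, map_sub, h1, AlgHom.commutes] at h3
  have h4 : valuation W (algebraMap k W.FunctionField (2 * t)) < 1 := by
    have e : algebraMap k W.FunctionField (2 * t) =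
        -(translation Q f - algebraMap k W.FunctionField t) -
          (-translation Q f - algebraMap k W.FunctionField t) := by
      rw [map_mul, map_ofNat]; ring
    rw [e]
    exact (Valuation.map_sub _ _ _).trans_lt (max_lt (by rwa [Valuation.map_neg]) h3)
  have h5 : t = 0 := (mul_eq_zero.mp (eq_zero_of_valuation_algebraMap_lt h4)).resolve_left h2
  rwa [h5, map_zero, sub_zero] at ht

/-- Subtracting a multiple of `g` from its negation `h` removes the pole at 0, hence by
`S`-invariance every pole, so `h = a g + b`. As negation is an involution and `g` is not constant,
`a = ±1`. An even `g` has zeros in the wrong place; an odd one, after a shift, has too many zeros at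
2-torsion. -/
lemma false_of_translation_eq (h2 : (2 : k) ≠ 0) {g : W.FunctionField} {S T Q₁ Q₂ : W.Point}
    (hg : ∀ P, valuation W (translation P g) =
      exp ((if P ∈ AddSubgroup.zmultiples S then 1 else 0) -
        (if P - T ∈ AddSubgroup.zmultiples S then 1 else 0) : ℤ))
    (hS : translation S g = g) (hT : T ∉ AddSubgroup.zmultiples S)
    (hTT : T + T ∉ AddSubgroup.zmultiples S)
    (hS2 : ∀ P ∈ AddSubgroup.zmultiples S, P + P = 0 → P = 0)
    (hQ₁ : Q₁ + Q₁ = 0) (hQ₁' : Q₁ ≠ 0) (hQ₂ : Q₂ + Q₂ = 0) (hQ₂' : Q₂ ≠ 0) (hne : Q₁ ≠ Q₂) :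
    False := by
  set Z := AddSubgroup.zmultiples S
  set v := valuation W
  have hT' : -T ∉ Z := fun h => hT (neg_mem_iff.mp h)
  have hTT' : -T - T ∉ Z := fun h => hTT (by rwa [← neg_mem_iff, neg_add, ← sub_eq_add_neg])
  have hvg : v g = exp 1 := by
    have := hg 0
    rwa [translation_zero, if_pos (zero_mem Z), zero_sub, if_neg hT', sub_zero] at this
  have hconst (t : k) : g ≠ algebraMap k W.FunctionField t := by
    rintro rfl
    have := valuation_algebraMap_base_le (W := W) t
    rw [show valuation W _ = exp 1 from hvg, ← exp_zero, exp_le_exp] at this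
    norm_num at this
  have hg0 : g ≠ 0 := by simpa using hconst 0
  have hgZ (P : W.Point) (hP : P ∉ Z) : v (translation P g) ≤ 1 := by
    rw [show v _ = _ from hg P, if_neg hP, ← exp_zero, exp_le_exp]
    split_ifs <;> norm_num
  set h := negation W g with hh
  have hvh : v h = exp 1 := (valuation_negation g).trans hvg
  have hhS : translation S h = h := by
    rw [hh, translation_negation]
    congr 1
    exact translation_eq_of_mem_zmultiples hS (neg_mem (AddSubgroup.mem_zmultiples S))
  obtain ⟨a, ha⟩ := exists_valuation_sub_lt (f := h) hg0 (hvh.trans hvg.symm).le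
  have hf : ∃ b, h - algebraMap k W.FunctionField a * g = algebraMap k W.FunctionField b := by
    refine exists_eq_algebraMap_of_forall_valuation_le fun P => ?_
    by_cases hP : P ∈ Z
    · rw [map_sub, map_mul, AlgHom.commutes, translation_eq_of_mem_zmultiples hhS hP,
        translation_eq_of_mem_zmultiples hS hP]
      rw [show valuation W g = exp (0 + 1) from hvg, lt_exp_add_one_iff] at ha
      exact ha
    · rw [map_sub, map_mul, AlgHom.commutes]
      refine (Valuation.map_sub _ _ _).trans (max_le ?_ ?_)
      · rw [valuation_translation_negation]
        exact hgZ _ fun h => hP (neg_mem_iff.mp h)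
      · rw [map_mul]
        exact mul_le_one' (valuation_algebraMap_base_le a) (hgZ P hP)
  obtain ⟨b, hb⟩ := hf
  have hnh : negation W h = g := negation_negation g
  have hb' := congrArg (negation W) hb
  rw [map_sub, map_mul, AlgHom.commutes, AlgHom.commutes, hnh, ← hh] at hb'
  have haa : a * a = 1 := by
    by_contra haa
    have haa' : 1 - a * a ≠ 0 := sub_ne_zero.mpr (Ne.symm haa)
    apply hconst ((a * b + b) / (1 - a * a))
    have : algebraMap k W.FunctionField (1 - a * a) ≠ 0 := (_root_.map_ne_zero _).mpr haa'
    rw [map_div₀, eq_div_iff this]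
    simp only [map_sub, map_add, map_mul, map_one]
    linear_combination hb' + algebraMap k W.FunctionField a * hb
  rcases mul_self_eq_one_iff.mp haa with rfl | rfl
  -- Here `g` is even, so its zero at `T` forces one at `-T`; but `-2T` is outside `⟨S⟩`.
  · have hgh : algebraMap k W.FunctionField (2 * b) = 0 := by
      rw [map_one, one_mul] at hb hb'
      rw [map_mul, map_ofNat]
      linear_combination -hb - hb'
    have hb0 : b = 0 := (mul_eq_zero.mp ((map_eq_zero _).mp hgh)).resolve_left h2
    rw [hb0, map_one, one_mul, map_zero, sub_eq_zero] at hb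
    have h1 := hg T
    rw [← hb, valuation_translation_negation, hg, if_neg hT, if_neg hT', if_neg hTT',
      sub_self T, if_pos (zero_mem Z), exp_inj] at h1
    norm_num at h1
  · set g' := g - algebraMap k W.FunctionField (b / 2) with hg'
    have hodd : negation W g' = -g' := by
      rw [hg', map_sub, AlgHom.commutes, ← hh]
      have e : algebraMap k W.FunctionField b = 2 * algebraMap k W.FunctionField (b / 2) := by
        rw [← map_ofNat (algebraMap k W.FunctionField), ← map_mul, mul_div_cancel₀ _ h2]
      rw [map_neg, map_one, e] at hb
      linear_combination hb
    have hg'0 : g' ≠ 0 := sub_ne_zero.mpr (hconst _)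
    have hg'S : translation S g' = g' := by rw [hg', map_sub, hS, AlgHom.commutes]
    have hg'Z (P : W.Point) (hP : P ∉ Z) : v (translation P g') ≤ 1 := by
      rw [hg', map_sub, AlgHom.commutes]
      exact (Valuation.map_sub _ _ _).trans (max_le (hgZ P hP) (valuation_algebraMap_base_le _))
    have hvg' : v g' ≤ exp 1 := by
      refine (Valuation.map_sub _ _ _).trans (max_le hvg.le
        ((valuation_algebraMap_base_le _).trans ?_))
      rw [← exp_zero, exp_le_exp]
      norm_num
    have hQ (Q : W.Point) (hQ : Q + Q = 0) (hQ' : Q ≠ 0) : v (translation Q g') < 1 :=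
      valuation_translation_lt_one_of_negation_eq_neg h2 hodd (neg_eq_of_add_eq_zero_left hQ)
        (hg'Z Q fun h => hQ' (hS2 Q h hQ))
    have hprod {s t : ℤᵐ⁰} (hs : s ≤ exp 1) (ht : t < 1) : s * t ≤ 1 := by
      have ht' : t ≤ exp (-1) := by rwa [← lt_exp_add_one_iff]
      calc s * t ≤ exp 1 * exp (-1) := mul_le_mul' hs ht'
        _ = 1 := by rw [← exp_add]; norm_num
    -- Each simple pole of one factor meets a zero of the other, since the odd function `g'`
    -- vanishes at `Q₁`.
    have hu : ∃ e, g' * translation Q₁ g' = algebraMap k W.FunctionField e := by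
      refine exists_eq_algebraMap_of_forall_valuation_le fun P => ?_
      rw [map_mul, translation_translation, map_mul]
      by_cases hP : P ∈ Z
      · have e : translation (P + Q₁) g' = translation Q₁ g' := by
          rw [add_comm, ← translation_translation, translation_eq_of_mem_zmultiples hg'S hP]
        rw [translation_eq_of_mem_zmultiples hg'S hP, e]
        exact hprod hvg' (hQ Q₁ hQ₁ hQ₁')
      by_cases hP' : P + Q₁ ∈ Z
      · have e : translation P g' = translation Q₁ g' := by
          have : P = Q₁ + (P + Q₁) := by
            rw [add_comm P, ← add_assoc, hQ₁, zero_add]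
          rw [this, ← translation_translation, translation_eq_of_mem_zmultiples hg'S hP']
        rw [translation_eq_of_mem_zmultiples hg'S hP', e, mul_comm]
        exact hprod hvg' (hQ Q₁ hQ₁ hQ₁')
      · exact mul_le_one' (hg'Z P hP) (hg'Z _ hP')
    obtain ⟨e, he⟩ := hu
    have he' := congrArg (fun f => v (translation Q₂ f)) he
    simp only [map_mul, translation_translation, AlgHom.commutes] at he'
    -- Evaluate at `Q₂`: both `Q₂` and `Q₂ + Q₁` are nonzero 2-torsion points, so the constant is 0.
    have hlt : v (algebraMap k W.FunctionField e) < 1 := by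
      rw [← he']
      refine mul_lt_one' (hQ Q₂ hQ₂ hQ₂') (hQ _ ?_ ?_)
      · rw [add_add_add_comm, hQ₂, hQ₁, add_zero]
      · intro h
        apply hne
        rw [← neg_eq_of_add_eq_zero_left hQ₁]
        exact neg_eq_of_add_eq_zero_left h
    rw [eq_zero_of_valuation_algebraMap_lt hlt, map_zero] at he
    rcases mul_eq_zero.mp he with h0 | h0
    · exact hg'0 h0
    · exact hg'0 ((_root_.map_eq_zero _).mp h0)

lemma exists_two_torsion (h2 : (2 : k) ≠ 0) : ∃ Q₁ Q₂ : W.Point,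
    Q₁ + Q₁ = 0 ∧ Q₁ ≠ 0 ∧ Q₂ + Q₂ = 0 ∧ Q₂ ≠ 0 ∧ Q₁ ≠ Q₂ := by
  have h4 : (WeierstrassCurve.twoTorsionPolynomial W).a ≠ 0 := by
    change (4 : k) ≠ 0
    rw [show (4 : k) = 2 * 2 by norm_num]
    exact mul_ne_zero h2 h2
  obtain ⟨x₁, x₂, x₃, h3⟩ := (Cubic.splits_iff_roots_eq_three (φ := RingHom.id k) h4).mp
    (IsAlgClosed.splits _)
  have hd := W.twoTorsionPolynomial_discr_ne_zero_of_isElliptic (isUnit_iff_ne_zero.mpr h2)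
  have hx := ((Cubic.discr_ne_zero_iff_roots_ne h4 h3).mp hd).1
  have hroot {t : k} (ht : t ∈ ({x₁, x₂, x₃} : Multiset k)) :
      ∃ h : W.Nonsingular t (-(W.a₁ * t + W.a₃) / 2),
        Point.some t (-(W.a₁ * t + W.a₃) / 2) h + Point.some t (-(W.a₁ * t + W.a₃) / 2) h = 0 := by
    rw [← h3, Cubic.map_roots, Polynomial.map_id, ← Cubic.roots,
      Cubic.mem_roots_iff (Cubic.ne_zero_of_a_ne_zero h4)] at ht
    simp only [twoTorsionPolynomial, b₂, b₄, b₆] at ht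
    have heq : W.Equation t (-(W.a₁ * t + W.a₃) / 2) := by
      rw [equation_iff]
      field_simp
      linear_combination -ht
    exact ⟨equation_iff_nonsingular.mp heq, Point.add_self_of_Y_eq (by rw [negY]; field_simp; ring)⟩
  obtain ⟨n₁, e₁⟩ := hroot (t := x₁) (by simp)
  obtain ⟨n₂, e₂⟩ := hroot (t := x₂) (by simp)
  refine ⟨_, _, e₁, Point.some_ne_zero _, e₂, Point.some_ne_zero _, fun h => hx ?_⟩
  rw [Point.some.injEq] at h
  exact h.1

/-- If the full `p`-torsion is rational over `K`, then `K` contains a nontrivial `p`-th root of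
unity. -/
theorem exists_root_of_unity (h2 : (2 : k) ≠ 0) {K : Subfield k} {G : AddSubgroup W.Point}
    (h₁ : W.a₁ ∈ K) (h₂ : W.a₂ ∈ K) (h₃ : W.a₃ ∈ K) (h₄ : W.a₄ ∈ K) (h₆ : W.a₆ ∈ K)
    (hG : ∀ x y h, Point.some x y h ∈ G → x ∈ K ∧ y ∈ K) {p : ℕ} (hp : p.Prime) (hodd : Odd p)
    (hGp : ∀ P ∈ G, p • P = 0) {S T : W.Point} (hS : S ∈ G) (hT : T ∈ G) (hS0 : S ≠ 0)
    (hST : T ∉ AddSubgroup.zmultiples S) : ∃ ζ ∈ K, ζ ^ p = 1 ∧ ζ ≠ 1 := by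
  obtain ⟨m, hm⟩ := hodd
  -- With `p = 2m + 1`, multiplication by `m + 1` halves points of `G`.
  have hhalf (P : W.Point) (hP : P ∈ G) : (m + 1) • P + (m + 1) • P = P := by
    rw [← add_nsmul, show m + 1 + (m + 1) = p + 1 by omega, succ_nsmul, hGp P hP, zero_add]
  have hG2 (P : W.Point) (hP : P ∈ G) (h : P + P = 0) : P = 0 := by
    rw [← hhalf P hP, ← nsmul_add, h, nsmul_zero]
  have hSG : AddSubgroup.zmultiples S ≤ G := AddSubgroup.zmultiples_le.mpr hS
  have : Fact p.Prime := ⟨hp⟩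
  have hSp : addOrderOf S = p := addOrderOf_eq_prime_iff.mpr ⟨hGp S hS, hS0⟩
  obtain ⟨g, hg, hgK⟩ := exists_divisor h₁ h₂ h₃ h₄ h₆ hG hG2
    (fun P hP => ⟨_, nsmul_mem hP _, hhalf P hP⟩) hS hT hp.pos hSp (hGp T hT)
  have hg0 : g ≠ 0 := by
    rintro rfl
    have := hg 0
    rw [map_zero, map_zero] at this
    exact exp_ne_zero this.symm
  have hSZ := AddSubgroup.mem_zmultiples S
  obtain ⟨t, ht⟩ := exists_eq_algebraMap_of_forall_valuation_le (f := translation S g / g) <| by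
    intro P
    rw [map_div₀, map_div₀, translation_translation, hg, hg, add_sub_right_comm]
    simp only [AddSubgroup.add_mem_cancel_right _ hSZ]
    rw [div_self exp_ne_zero]
  have htK : t ^ 2 ∈ K := by
    refine NormLeadingCoeffMem.sq_mem (W := W) ?_
    rw [← ht, div_eq_mul_inv]
    refine (hgK S hS).mul (NormLeadingCoeffMem.inv ?_)
    have := hgK 0 (zero_mem G)
    rwa [translation_zero] at this
  rw [div_eq_iff hg0] at ht
  have hpow (n : ℕ) : translation (n • S) g = algebraMap k W.FunctionField (t ^ n) * g := by
    induction n with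
    | zero => rw [zero_nsmul, translation_zero, pow_zero, map_one, one_mul]
    | succ n ih =>
      rw [succ_nsmul, ← translation_translation, ht, map_mul, AlgHom.commutes, ih, pow_succ,
        map_mul]
      ring
  have htp : t ^ p = 1 := by
    have := hpow p
    rw [hGp S hS, translation_zero, eq_comm, mul_eq_right₀ hg0] at this
    exact (algebraMap k W.FunctionField).injective (this.trans (map_one _).symm)
  refine ⟨t, ?_, htp, ?_⟩
  -- `2(m + 1) = p + 1` and `t ^ p = 1`, so `t` is recovered from `t²`.
  · have : t = (t ^ 2) ^ (m + 1) := by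
      rw [← pow_mul, show 2 * (m + 1) = p + 1 by omega, pow_succ, htp, one_mul]
    rw [this]
    exact pow_mem htK _
  · rintro rfl
    rw [map_one, one_mul] at ht
    obtain ⟨Q₁, Q₂, e₁, e₂, e₃, e₄, e₅⟩ := exists_two_torsion (W := W) h2
    refine false_of_translation_eq h2 hg ht hST (fun h => hST ?_)
      (fun P hP => hG2 P (hSG hP)) e₁ e₂ e₃ e₄ e₅
    rw [← hhalf T hT, ← nsmul_add]
    exact nsmul_mem h _

end FunctionField

end WeierstrassCurve.Affine

/-! ### Roots of unity in quadratic extensions of imaginary quadratic fields. -/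

section RootsOfUnity

/-- A primitive fifth root of unity of a quartic field cannot have an imaginary quadratic subfield. -/
lemma not_isPrimitiveRoot_five (K : Type*) [Field K] [NumberField K]
    [Algebra.IsQuadraticExtension ℚ K] [NumberField.IsTotallyComplex K] (L : Type*) [Field L]
    [NumberField L] [Algebra K L] (h4 : Module.finrank ℚ L = 4) (ζ : L) :
    ¬ IsPrimitiveRoot ζ 5 := by
  intro hζ
  have hdeg : (minpoly ℚ ζ).natDegree = 4 := by
    rw [← cyclotomic_eq_minpoly_rat hζ (by norm_num), natDegree_cyclotomic]
    rfl
  have htop : IntermediateField.adjoin ℚ {ζ} = ⊤ :=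
    (Field.primitive_element_iff_minpoly_natDegree_eq ℚ ζ).mpr (hdeg.trans h4.symm)
  have hcyc : IsCyclotomicExtension {5} ℚ L := by
    refine (IsCyclotomicExtension.iff_singleton 5 ℚ L).mpr ⟨⟨ζ, hζ⟩, fun x => ?_⟩
    have hx : x ∈ (IntermediateField.adjoin ℚ {ζ}).toSubalgebra := by
      rw [htop]; trivial
    rw [IntermediateField.adjoin_simple_toSubalgebra_of_isAlgebraic
      (Algebra.IsAlgebraic.isAlgebraic ζ)] at hx
    have hsub : ({ζ} : Set L) ⊆ {b : L | b ^ 5 = 1} := by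
      rintro _ rfl
      exact hζ.pow_eq_one
    exact Algebra.adjoin_mono hsub hx
  have hgal : IsGalois ℚ L := IsCyclotomicExtension.isGalois {5} ℚ L
  obtain ⟨φ⟩ : Nonempty (L →+* ℂ) := inferInstance
  obtain ⟨τ, hτ⟩ := NumberField.ComplexEmbedding.exists_comp_symm_eq_of_comp_eq (k := ℚ) φ
    (NumberField.ComplexEmbedding.conjugate φ) (Subsingleton.elim _ _)
  have hττ : τ.symm * τ.symm = 1 := by
    ext x
    apply φ.injective
    have h1 (x : L) : φ (τ.symm x) = starRingEnd ℂ (φ x) := RingHom.congr_fun hτ x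
    rw [AlgEquiv.mul_apply, h1, h1, Complex.conj_conj, AlgEquiv.one_apply]
  let e := IsCyclotomicExtension.autEquivPow L (n := 5) (K := ℚ)
    (cyclotomic.irreducible_rat (by norm_num))
  -- The unit group is cyclic of order 4, so complex conjugation, here `τ.symm`, is a square in the
  -- Galois group. Squares restrict trivially to the quadratic field `K`, which thus acquires a real
  -- embedding.
  have hsq : ∀ u : (ZMod 5)ˣ, u * u = 1 → ∃ w, u = w * w := by decide
  obtain ⟨w, hw⟩ := hsq (e τ.symm) (by rw [← map_mul, hττ, map_one])
  have hσ : τ.symm = e.symm w * e.symm w := by rw [← map_mul, ← hw, e.symm_apply_apply]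
  have hcard : Fintype.card Gal(K/ℚ) = 2 := by
    rw [← Nat.card_eq_fintype_card, IsGalois.card_aut_eq_finrank,
      Algebra.IsQuadraticExtension.finrank_eq_two]
  have hfix (x : K) : τ.symm (algebraMap K L x) = algebraMap K L x := by
    have h1 : AlgEquiv.restrictNormalHom K τ.symm = 1 := by
      rw [hσ, map_mul, ← pow_two, ← hcard, pow_card_eq_one]
    have h2 := AlgEquiv.restrictNormal_commutes τ.symm K x
    change algebraMap K L (AlgEquiv.restrictNormalHom K τ.symm x) = _ at h2
    rw [h1, AlgEquiv.one_apply] at h2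
    exact h2.symm
  have hreal : NumberField.ComplexEmbedding.IsReal (φ.comp (algebraMap K L)) := by
    ext x
    have := RingHom.congr_fun hτ (algebraMap K L x)
    rw [RingHom.comp_apply] at this
    change φ (τ.symm _) = _ at this
    rw [hfix] at this
    exact this.symm
  exact NumberField.InfinitePlace.not_isReal_iff_isComplex.mpr
    (NumberField.IsTotallyComplex.isComplex (.mk (φ.comp (algebraMap K L)))) ⟨_, hreal, rfl⟩

lemma eq_three_of_isPrimitiveRoot (K : Type*) [Field K] [NumberField K]
    [Algebra.IsQuadraticExtension ℚ K] [NumberField.IsTotallyComplex K] (L : Type*) [Field L]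
    [Algebra K L] [Algebra.IsQuadraticExtension K L] {p : ℕ} (hp : p.Prime) (hodd : Odd p) {ζ : L}
    (hζ : IsPrimitiveRoot ζ p) : p = 3 := by
  have : CharZero L := charZero_of_injective_algebraMap (algebraMap K L).injective
  have h4 : Module.finrank ℚ L = 4 := by
    rw [← Module.finrank_mul_finrank ℚ K L, Algebra.IsQuadraticExtension.finrank_eq_two,
      Algebra.IsQuadraticExtension.finrank_eq_two]
  have hfin : FiniteDimensional ℚ L := Module.finite_of_finrank_pos (by omega)
  have : NumberField L := ⟨⟩
  have hdvd : p - 1 ∣ 4 := by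
    have := minpoly.degree_dvd (Algebra.IsIntegral.isIntegral (R := ℚ) ζ)
    rwa [← cyclotomic_eq_minpoly_rat hζ hp.pos, natDegree_cyclotomic, Nat.totient_prime hp,
      h4] at this
  have hle := Nat.le_of_dvd (by norm_num) hdvd
  have hp2 := hp.two_le
  have hp5 : p ≤ 5 := by omega
  interval_cases p
  · exact absurd hodd (by decide)
  · rfl
  · exact absurd hp (by decide)
  · exact absurd hζ (not_isPrimitiveRoot_five K L h4 ζ)

end RootsOfUnity

/-! ### From full torsion over `L` to a root of unity in `L`. -/

section Torsion

open WeierstrassCurve WeierstrassCurve.Affine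

/-- `exists_root_of_unity` is applied over an algebraic closure, with the image of `L` as the
subfield and the image of `H` as the group of rational points. -/
lemma exists_isPrimitiveRoot_of_full_torsion {L : Type*} [Field L] [CharZero L]
    [DecidableEq L] (E : WeierstrassCurve L) [E.IsElliptic] {p : ℕ} (hp : p.Prime) (hodd : Odd p)
    (H : AddSubgroup E.toAffine.Point) (e : ZMod p × ZMod p ≃+ H) :
    ∃ ζ : L, IsPrimitiveRoot ζ p := by
  classical
  let k := AlgebraicClosure L
  let W : Affine k := E.toAffine.baseChange k
  have hW : W.IsElliptic := inferInstanceAs ((E.map (algebraMap L k)).IsElliptic)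
  let f : E.toAffine.Point →+ W.Point :=
    Point.map (W' := E.toAffine) (F := L) (S := L) (Algebra.ofId L k)
  have hf : Function.Injective f := Point.map_injective _
  have : Fact p.Prime := ⟨hp⟩
  have hchar : CharZero k := charZero_of_injective_algebraMap (algebraMap L k).injective
  let S : E.toAffine.Point := e (1, 0)
  let T : E.toAffine.Point := e (0, 1)
  have hST : f T ∉ AddSubgroup.zmultiples (f S) := by
    rintro ⟨n, hn⟩
    have h1 : n • S = T := hf (by rw [map_zsmul]; exact hn)
    have h2 : n • ((1, 0) : ZMod p × ZMod p) = (0, 1) :=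
      e.injective (Subtype.ext (by rw [map_zsmul]; exact h1))
    simpa using congrArg Prod.snd h2
  have hS0 : f S ≠ 0 := by
    intro h
    have h1 : S = 0 := hf (h.trans (map_zero f).symm)
    have h2 : ((1, 0) : ZMod p × ZMod p) = 0 :=
      e.injective (Subtype.ext (by rw [map_zero]; exact h1))
    simpa using congrArg Prod.fst h2
  obtain ⟨ζ, ⟨z, rfl⟩, hζ, hζ1⟩ := FunctionField.exists_root_of_unity (W := W)
    (K := (algebraMap L k).fieldRange) (G := H.map f) two_ne_zero ⟨E.a₁, rfl⟩ ⟨E.a₂, rfl⟩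
    ⟨E.a₃, rfl⟩ ⟨E.a₄, rfl⟩ ⟨E.a₆, rfl⟩ (by
      rintro x y h ⟨P, -, hP⟩
      rcases P with _ | ⟨x₀, y₀, h₀⟩
      · exact absurd hP.symm (Point.some_ne_zero h)
      · have hP' : Point.some (algebraMap L k x₀) (algebraMap L k y₀) _ = Point.some x y h := hP
        have hxy := Point.some.inj hP'
        exact ⟨⟨x₀, hxy.1⟩, ⟨y₀, hxy.2⟩⟩) hp hodd (by
      rintro - ⟨P, hP, rfl⟩
      rw [← map_nsmul]
      have h1 : p • (⟨P, hP⟩ : H) = 0 := by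
        rw [← e.apply_symm_apply ⟨P, hP⟩, ← map_nsmul]
        have (a : ZMod p × ZMod p) : p • a = 0 := by ext <;> simp
        rw [this, map_zero]
      have h2 : p • P = 0 := congrArg Subtype.val h1
      rw [h2, map_zero]) ⟨S, (e (1, 0)).2, rfl⟩ ⟨T, (e (0, 1)).2, rfl⟩ hS0 hST
  have hz : z ^ p = 1 := (algebraMap L k).injective (by rw [map_pow, map_one]; exact hζ)
  have hz1 : z ≠ 1 := by rintro rfl; exact hζ1 (map_one _)
  exact ⟨z, IsPrimitiveRoot.iff_orderOf.mpr (orderOf_eq_prime hz hz1)⟩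

end Torsion

/-! ### A curve with full 3-torsion. -/

section Example

open WeierstrassCurve WeierstrassCurve.Affine

/-- The full 3-torsion of `y² = x³ + 16` is rational over any field containing `√-3`. -/
lemma exists_full_three_torsion {L : Type*} [Field L] [CharZero L] [DecidableEq L] {s : L}
    (hs : s ^ 2 = -3) (W : WeierstrassCurve L) (hW : W = ⟨0, 0, 0, 0, 16⟩) :
    ∃ H : AddSubgroup W.toAffine.Point, Nonempty (ZMod 3 × ZMod 3 ≃+ H) := by
  subst hW
  set W : Affine L := ⟨0, 0, 0, 0, 16⟩ with hW
  have hs0 : s ≠ 0 := by rintro rfl; norm_num at hs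
  have h8 : (4 : L) ≠ -4 := by norm_num
  have h8s : 4 * s ≠ -(4 * s) := by
    intro h
    exact hs0 (by linear_combination h / 8)
  have hS : W.Nonsingular 0 4 := by
    rw [nonsingular_iff, equation_iff]
    simp [hW]
    norm_num
  have hT : W.Nonsingular (-4) (4 * s) := by
    rw [nonsingular_iff, equation_iff]
    simp only [hW]
    refine ⟨by linear_combination 16 * hs, Or.inl (by norm_num)⟩
  let S : W.Point := .some _ _ hS
  let T : W.Point := .some _ _ hT
  have hS3 : (3 : ℤ) • S = 0 := by
    have hne : (4 : L) ≠ W.negY 0 4 := by simpa [negY, hW] using h8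
    -- `S` is a flex: the tangent there is the horizontal line `y = 4`.
    have : S + S = -S := by
      rw [Point.add_self_of_Y_ne hne, Point.neg_some, Point.some.injEq,
        slope_of_Y_ne rfl hne]
      constructor <;> simp [hW, addY, negY]
    rw [show (3 : ℤ) = 1 + 1 + 1 by norm_num, add_zsmul, add_zsmul, one_zsmul, this,
      neg_add_cancel]
  have hT3 : (3 : ℤ) • T = 0 := by
    have hne : 4 * s ≠ W.negY (-4) (4 * s) := by simpa [negY, hW] using h8s
    -- The slope is `3·16 / (8s) = 6/s`, and `s² = -3` turns this into `-2s`.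
    have hsl : W.slope (-4) (-4) (4 * s) (4 * s) = -2 * s := by
      rw [slope_of_Y_ne rfl hne]
      simp only [hW, negY]
      field_simp
      linear_combination 16 * hs
    have : T + T = -T := by
      rw [Point.add_self_of_Y_ne hne, Point.neg_some, Point.some.injEq, hsl]
      simp only [hW, addY, negY, addX, negAddY]
      exact ⟨by linear_combination 4 * hs, by linear_combination 8 * s * hs⟩
    rw [show (3 : ℤ) = 1 + 1 + 1 by norm_num, add_zsmul, add_zsmul, one_zsmul, this,
      neg_add_cancel]
  have hne (Q : W.Point) (hQ : Q = S ∨ Q = -S) : T ≠ Q := by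
    rintro rfl
    rcases hQ with h | h
    · rw [Point.some.injEq] at h
      norm_num at h
    · rw [Point.neg_some, Point.some.injEq] at h
      norm_num at h
  let fS : ZMod 3 →+ W.Point := ZMod.lift 3 ⟨zmultiplesHom _ S, hS3⟩
  let fT : ZMod 3 →+ W.Point := ZMod.lift 3 ⟨zmultiplesHom _ T, hT3⟩
  have hfS : fS 1 = S := by
    have := ZMod.lift_coe 3 ⟨zmultiplesHom _ S, hS3⟩ 1
    simpa using this
  have hfT : fT 1 = T := by
    have := ZMod.lift_coe 3 ⟨zmultiplesHom _ T, hT3⟩ 1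
    simpa using this
  let ψ : ZMod 3 × ZMod 3 →+ W.Point := fS.coprod fT
  have hψ : Function.Injective ψ := by
    rw [injective_iff_map_eq_zero]
    rintro ⟨i, j⟩ hij
    rw [AddMonoidHom.coprod_apply] at hij
    have h3 : ∀ i : ZMod 3, i = 0 ∨ i = 1 ∨ i = -1 := by decide
    have hS0 : S ≠ 0 := Point.some_ne_zero hS
    have hT0 : T ≠ 0 := Point.some_ne_zero hT
    have h₁ := hne S (Or.inl rfl)
    have h₂ := hne (-S) (Or.inr rfl)
    have h₂' : S + T ≠ 0 := fun h => h₂ (neg_eq_of_add_eq_zero_right h).symm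
    have h₁' : S + -T ≠ 0 := fun h => h₁ (add_neg_eq_zero.mp h).symm
    rcases h3 i with rfl | rfl | rfl <;> rcases h3 j with rfl | rfl | rfl <;>
      simp only [map_zero, map_neg, hfS, hfT, zero_add, add_zero, neg_eq_zero] at hij
    · rfl
    · exact absurd hij hT0
    · exact absurd hij hT0
    · exact absurd hij hS0
    · exact absurd hij h₂'
    · exact absurd hij h₁'
    · exact absurd hij hS0
    · exact absurd (by rw [← neg_eq_zero, neg_add, neg_neg]; exact hij) h₁'
    · exact absurd (by rw [← neg_eq_zero, neg_add]; exact hij) h₂'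
  exact ⟨ψ.range, ⟨AddMonoidHom.ofInjective hψ⟩⟩

lemma exists_quadraticExtension {K : Type u} [Field K] {a : K} (ha : ¬ IsSquare a) :
    ∃ (L : Type u) (_ : Field L) (_ : Algebra K L),
      Algebra.IsQuadraticExtension K L ∧ ∃ s : L, s ^ 2 = algebraMap K L a := by
  have hirr : Irreducible (X ^ 2 - C a) :=
    (X_pow_sub_C_irreducible_iff_of_prime Nat.prime_two).mpr fun b hb =>
      ha ⟨b, by rw [← hb, sq]⟩
  have : Fact (Irreducible (X ^ 2 - C a)) := ⟨hirr⟩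
  refine ⟨AdjoinRoot (X ^ 2 - C a), inferInstance, inferInstance, ⟨?_⟩,
    AdjoinRoot.root (X ^ 2 - C a), ?_⟩
  · rw [(AdjoinRoot.powerBasis hirr.ne_zero).finrank, AdjoinRoot.powerBasis_dim,
      natDegree_X_pow_sub_C]
  · have := AdjoinRoot.eval₂_root (X ^ 2 - C a)
    rw [eval₂_sub, eval₂_pow, eval₂_X, eval₂_C, sub_eq_zero] at this
    exact this

/-- Since `K` has dimension 2, a square root `t` of 2 would satisfy a rational relation with 1 and
`s`. Multiplying it by the conjugate in `t` gives `(g₀ + g₁ s)² = 2 g₂²`. This forces 2 to be a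
rational square or a negative number to equal a positive one. -/
lemma not_isSquare_two_of_sq_eq_neg_three {K : Type*} [Field K] [CharZero K]
    [Algebra.IsQuadraticExtension ℚ K] {s : K} (hs : s ^ 2 = -3) : ¬ IsSquare (2 : K) := by
  rintro ⟨t, ht⟩
  have hdep : ¬ LinearIndependent ℚ ![1, s, t] := fun h => by
    have := h.fintype_card_le_finrank
    rw [Algebra.IsQuadraticExtension.finrank_eq_two, Fintype.card_fin] at this
    omega
  obtain ⟨g, hg, i, hi⟩ := Fintype.not_linearIndependent_iff.mp hdep
  simp only [Fin.sum_univ_three, Matrix.cons_val_zero, Matrix.cons_val_one, Matrix.cons_val,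
    Rat.smul_def, mul_one] at hg
  have hirr (a b : ℚ) (h : (a : K) + b * s = 0) : a = 0 ∧ b = 0 := by
    have h1 : ((a ^ 2 + 3 * b ^ 2 : ℚ) : K) = 0 := by
      push_cast
      linear_combination (a - b * s) * h + b ^ 2 * hs
    have h2 : a ^ 2 + 3 * b ^ 2 = 0 := by exact_mod_cast h1
    constructor <;> nlinarith [sq_nonneg a, sq_nonneg b]
  have hsq : ((g 0 ^ 2 - 3 * g 1 ^ 2 - 2 * g 2 ^ 2 : ℚ) : K) + ((2 * g 0 * g 1 : ℚ) : K) * s = 0 := by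
    push_cast
    linear_combination (g 0 + g 1 * s - g 2 * t) * hg - g 1 ^ 2 * hs - g 2 ^ 2 * ht
  obtain ⟨h1, h2⟩ := hirr _ _ hsq
  have hg2 : g 2 ≠ 0 := by
    intro h
    rw [h, Rat.cast_zero, zero_mul, add_zero] at hg
    obtain ⟨h3, h4⟩ := hirr _ _ hg
    fin_cases i
    · exact hi h3
    · exact hi h4
    · exact hi h
  have hpos : 0 < g 2 ^ 2 := by positivity
  rcases mul_eq_zero.mp h2 with h3 | h3
  · have h4 : g 0 = 0 := by linarith
    rw [h4] at h1
    nlinarith [sq_nonneg (g 1)]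
  · rw [h3] at h1
    have : IsSquare (2 : ℚ) := ⟨g 0 / g 2, by field_simp; linarith⟩
    norm_num at this

end Example

theorem mainTheorem6 (K : Type u) [Field K] [NumberField K]
    [Algebra.IsQuadraticExtension ℚ K] [NumberField.IsTotallyComplex K] :
    (∀ (L : Type v) [Field L] [Algebra K L] [Algebra.IsQuadraticExtension K L]
        (E : WeierstrassCurve K) [E.IsElliptic] (p : ℕ),
        p.Prime → Odd p → ContainsFullTorsion E L p → p = 3) ∧
    (∃ (L : Type u) (_ : Field L) (_ : Algebra K L) (E : WeierstrassCurve K),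
        Algebra.IsQuadraticExtension K L ∧ E.IsElliptic ∧ ContainsFullTorsion E L 3) := by
  classical
  constructor
  · rintro L _ _ _ E _ p hp hodd ⟨H, ⟨e⟩⟩
    have : CharZero L := charZero_of_injective_algebraMap (algebraMap K L).injective
    have : (E.baseChange L).IsElliptic := inferInstanceAs (E.map (algebraMap K L)).IsElliptic
    obtain ⟨ζ, hζ⟩ := exists_isPrimitiveRoot_of_full_torsion (E.baseChange L) hp hodd H e
    exact eq_three_of_isPrimitiveRoot K L hp hodd hζ
  · have hL : ∃ (L : Type u) (_ : Field L) (_ : Algebra K L),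
        Algebra.IsQuadraticExtension K L ∧ ∃ s : L, s ^ 2 = -3 := by
      by_cases h3 : IsSquare (-3 : K)
      -- When `√-3` already lies in `K`, any quadratic extension will do; adjoining `√2` provides
      -- one.
      · obtain ⟨s, hs⟩ := h3
        have hs' : s ^ 2 = -3 := by rw [hs, sq]
        obtain ⟨L, i₁, i₂, hL, -⟩ :=
          exists_quadraticExtension (not_isSquare_two_of_sq_eq_neg_three hs')
        exact ⟨L, i₁, i₂, hL, algebraMap K L s, by rw [← map_pow, hs', map_neg, map_ofNat]⟩
      · obtain ⟨L, i₁, i₂, hL, s, hs⟩ := exists_quadraticExtension h3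
        exact ⟨L, i₁, i₂, hL, s, by rw [hs, map_neg, map_ofNat]⟩
    obtain ⟨L, i₁, i₂, hL, s, hs⟩ := hL
    have : CharZero L := charZero_of_injective_algebraMap (algebraMap K L).injective
    refine ⟨L, i₁, i₂, ⟨0, 0, 0, 0, 16⟩, hL, ⟨isUnit_iff_ne_zero.mpr ?_⟩, ?_⟩
    · simp only [WeierstrassCurve.Δ, WeierstrassCurve.b₂, WeierstrassCurve.b₄,
        WeierstrassCurve.b₆, WeierstrassCurve.b₈]
      norm_num
    · refine exists_full_three_torsion hs _ ?_
      ext <;> simp [map_ofNat (algebraMap K L) 16]
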